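/- For $\theta\in(0,\frac\pi2)$ let $$\Omega_\theta=\Big\{(x_1,x_2)\in\mathbb R^2:\ x_1\tan\theta<|x_2|<\Big(x_1+\frac{\pi}{\sin\theta}\Big)\tan\theta\Big\}$$ be the broken guide with half-opening $\theta$, and let $\Delta^{\mathsf{Dir}}_{\Omega_\theta}$ be the positive Dirichlet Laplacian on $\Omega_\theta$, that is, the unbounded operator $u\mapsto-\Delta u$ (in the sense of distributions) in the complex Hilbert space $L^2(\Omega_\theta)$ with domain $\{u\in H^1_0(\Omega_\theta):\ \Delta u\in L^2(\Omega_\theta)\}$, where $H^1_0(\Omega_\theta)$ is the closure of $C_c^\infty(\Omega_\theta)$ in $H^1(\Omega_\theta)$. The essential spectrum $\sigma_{\mathsf{ess}}(A)$ of an operator $A$ with domain $\mathsf{Dom}(A)$ in a complex Hilbert space $H$ is the set of $\lambda\in\mathbb C$ such that $A-\lambda\,\mathrm{Id}$ is not Fredholm from $\mathsf{Dom}(A)$ into $H$; Fredholm means that the kernel is finite dimensional and that the range is closed and of finite codimension. Then, for every $\theta\in(0,\frac\pi2)$, $$\sigma_{\mathsf{ess}}\big(\Delta^{\mathsf{Dir}}_{\Omega_\theta}\big)=[1,+\infty).$$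 -/

import Mathlib

open MeasureTheory TopologicalSpace
open scoped ENNReal ContDiff Distributions

noncomputable section

namespace BrokenGuide

/-! ### Essential spectrum of an unbounded operator -/

section Spectrum

variable {H : Type*} [NormedAddCommGroup H] [InnerProductSpace ℂ H]

/-- `A - z Id`, as a linear map from `Dom(A)` into `H`. -/
def subScalar (A : H →ₗ.[ℂ] H) (z : ℂ) : A.domain →ₗ[ℂ] H :=
  A.toFun - z • A.domain.subtype

/-- A linear map `T : D → H` is Fredholm if its kernel is finite dimensional and its range is closed
with finite codimension. It is meant for unbounded operators (`D` a subspace of `H` on which `T` is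
closed but not continuous for the norm of `H`), so that `ContinuousLinearMap.IsFredholm` does not
apply. -/
structure IsFredholm {D : Type*} [AddCommGroup D] [Module ℂ D] (T : D →ₗ[ℂ] H) : Prop where
  finite_ker : FiniteDimensional ℂ (LinearMap.ker T)
  isClosed_range : IsClosed (LinearMap.range T : Set H)
  finite_coker : FiniteDimensional ℂ (H ⧸ LinearMap.range T)

/-- The essential spectrum of `A`: the complex numbers `z` such that `A - z Id` is not Fredholm
from `Dom(A)` into `H`. -/
def essentialSpectrum (A : H →ₗ.[ℂ] H) : Set ℂ :=
  {z | ¬ IsFredholm (subScalar A z)}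

end Spectrum

/-! ### The Dirichlet Laplacian on an open subset of `ℝᵈ` -/

section Dirichlet

variable {d : ℕ} (Ω : Opens (EuclideanSpace ℝ (Fin d)))

/-- The complex Hilbert space `L²(Ω)`. -/
abbrev L2 : Type :=
  Lp ℂ 2 (volume.restrict (Ω : Set (EuclideanSpace ℝ (Fin d))))

variable {Ω}

/-- The partial derivative `∂ᵢ φ` of a function on `ℝᵈ`. -/
def partialDeriv (i : Fin d) (φ : EuclideanSpace ℝ (Fin d) → ℂ) (x : EuclideanSpace ℝ (Fin d)) : ℂ :=
  fderiv ℝ φ x (EuclideanSpace.single i 1)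

/-- `g` is the weak gradient of `u` in `Ω`: `∫ u ∂ᵢφ = - ∫ gᵢ φ` for all test functions. -/
def IsWeakGradient (u : L2 Ω) (g : Fin d → L2 Ω) : Prop :=
  ∀ (φ : 𝓓(Ω, ℂ)) (i : Fin d),
    ∫ x in (Ω : Set (EuclideanSpace ℝ (Fin d))), u x * partialDeriv i φ x =
      - ∫ x in (Ω : Set (EuclideanSpace ℝ (Fin d))), g i x * φ x

/-- `f = Δu` in the sense of distributions in `Ω`: `∫ u Δφ = ∫ f φ` for all test functions. -/
def IsWeakLaplacian (u f : L2 Ω) : Prop :=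
  ∀ φ : 𝓓(Ω, ℂ),
    ∫ x in (Ω : Set (EuclideanSpace ℝ (Fin d))), u x * Laplacian.laplacian (φ : _ → ℂ) x =
      ∫ x in (Ω : Set (EuclideanSpace ℝ (Fin d))), f x * φ x

/-- `u ∈ H¹₀(Ω)`: `u` belongs to `H¹(Ω)` (it has a weak gradient `g` in `L²(Ω)`), and it is a limit
of test functions in the norm of `H¹(Ω)`. -/
def MemH10 (u : L2 Ω) : Prop :=
  ∃ g : Fin d → L2 Ω, IsWeakGradient u g ∧
    ∀ ε : ℝ≥0∞, 0 < ε → ∃ φ : 𝓓(Ω, ℂ),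
      eLpNorm (fun x => u x - φ x) 2 (volume.restrict (Ω : Set (EuclideanSpace ℝ (Fin d)))) < ε ∧
      ∀ i, eLpNorm (fun x => g i x - partialDeriv i φ x) 2
        (volume.restrict (Ω : Set (EuclideanSpace ℝ (Fin d)))) < ε

lemma continuous_partialDeriv (φ : 𝓓(Ω, ℂ)) (i : Fin d) : Continuous (partialDeriv i φ) :=
  (φ.contDiff.continuous_fderiv (by simp)).clm_apply continuous_const

lemma hasCompactSupport_partialDeriv (φ : 𝓓(Ω, ℂ)) (i : Fin d) :
    HasCompactSupport (partialDeriv i φ) :=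
  φ.hasCompactSupport.fderiv_apply (𝕜 := ℝ) (EuclideanSpace.single i 1)

lemma continuous_laplacian (φ : 𝓓(Ω, ℂ)) : Continuous (Laplacian.laplacian (φ : _ → ℂ)) := by
  rw [InnerProductSpace.laplacian_eq_iteratedFDeriv_stdOrthonormalBasis]
  refine continuous_finsetSum _ fun i _ => ?_
  have h := φ.contDiff.continuous_iteratedFDeriv (m := 2) (by
    exact WithTop.coe_le_coe.mpr (le_top : (2 : ℕ∞) ≤ ⊤))
  fun_prop

lemma hasCompactSupport_laplacian (φ : 𝓓(Ω, ℂ)) :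
    HasCompactSupport (Laplacian.laplacian (φ : _ → ℂ)) := by
  refine (φ.hasCompactSupport.iteratedFDeriv (𝕜 := ℝ) 2).mono ?_
  intro x hx h0
  apply hx
  rw [InnerProductSpace.laplacian_eq_iteratedFDeriv_stdOrthonormalBasis]
  simp only [h0, zero_apply, Finset.sum_const_zero]

lemma integrable_pair (u : L2 Ω) {ψ : EuclideanSpace ℝ (Fin d) → ℂ} (hc : Continuous ψ)
    (hs : HasCompactSupport ψ) :
    Integrable (fun x => u x * ψ x) (volume.restrict (Ω : Set (EuclideanSpace ℝ (Fin d)))) :=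
  (Lp.memLp u).integrable_mul (q := 2) (hc.memLp_of_hasCompactSupport hs)

lemma pair_add (u v : L2 Ω) {ψ : EuclideanSpace ℝ (Fin d) → ℂ} (hc : Continuous ψ)
    (hs : HasCompactSupport ψ) :
    ∫ x in (Ω : Set (EuclideanSpace ℝ (Fin d))), (u + v : L2 Ω) x * ψ x =
      (∫ x in (Ω : Set (EuclideanSpace ℝ (Fin d))), u x * ψ x) +
        ∫ x in (Ω : Set (EuclideanSpace ℝ (Fin d))), v x * ψ x := by
  rw [← integral_add (integrable_pair u hc hs) (integrable_pair v hc hs)]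
  refine integral_congr_ae ?_
  filter_upwards [Lp.coeFn_add u v] with x hx
  rw [hx, Pi.add_apply, add_mul]

lemma pair_smul (c : ℂ) (u : L2 Ω) (ψ : EuclideanSpace ℝ (Fin d) → ℂ) :
    ∫ x in (Ω : Set (EuclideanSpace ℝ (Fin d))), (c • u : L2 Ω) x * ψ x =
      c * ∫ x in (Ω : Set (EuclideanSpace ℝ (Fin d))), u x * ψ x := by
  rw [← integral_const_mul]
  refine integral_congr_ae ?_
  filter_upwards [Lp.coeFn_smul c u] with x hx
  rw [hx, Pi.smul_apply, smul_eq_mul, mul_assoc]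

lemma IsWeakLaplacian.add {u v f g : L2 Ω} (hu : IsWeakLaplacian u f) (hv : IsWeakLaplacian v g) :
    IsWeakLaplacian (u + v) (f + g) := fun φ => by
  rw [pair_add u v (continuous_laplacian φ) (hasCompactSupport_laplacian φ),
    pair_add f g φ.continuous φ.hasCompactSupport, hu φ, hv φ]

lemma IsWeakLaplacian.smul {u f : L2 Ω} (c : ℂ) (hu : IsWeakLaplacian u f) :
    IsWeakLaplacian (c • u) (c • f) := fun φ => by
  rw [pair_smul, pair_smul, hu φ]

/-- The distributional Laplacian, when it is in `L²(Ω)`, is unique. -/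
lemma IsWeakLaplacian.unique {u f g : L2 Ω} (hf : IsWeakLaplacian u f)
    (hg : IsWeakLaplacian u g) : f = g := by
  have hloc : ∀ h : L2 Ω, LocallyIntegrable h
      (volume.restrict (Ω : Set (EuclideanSpace ℝ (Fin d)))) := fun h =>
    (Lp.memLp h).locallyIntegrable (by norm_num)
  have key := Ω.isOpen.ae_eq_zero_of_integral_contDiff_smul_eq_zero
    (((hloc f).sub (hloc g)).locallyIntegrableOn Ω) (by
      intro φ hφ hc hs
      let ψ : 𝓓(Ω, ℂ) := ⟨fun x => (φ x : ℂ), Complex.ofRealCLM.contDiff.comp hφ,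
        hc.comp_left (g := Complex.ofReal) Complex.ofReal_zero,
        (closure_mono (Function.support_comp_subset Complex.ofReal_zero φ)).trans hs⟩
      have h1 := (hf ψ).symm.trans (hg ψ)
      rw [← sub_eq_zero, ← integral_sub (integrable_pair f ψ.continuous ψ.hasCompactSupport)
        (integrable_pair g ψ.continuous ψ.hasCompactSupport)] at h1
      rw [← h1]
      refine integral_congr_ae (Filter.Eventually.of_forall fun x => ?_)
      change (φ x) • (f x - g x) = f x * (φ x : ℂ) - g x * (φ x : ℂ)
      rw [Complex.real_smul]
      ring)
  refine Lp.ext ?_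
  filter_upwards [key, ae_restrict_mem Ω.isOpen.measurableSet] with x hx hxm
  exact sub_eq_zero.mp (hx hxm)

lemma MemH10.zero : MemH10 (0 : L2 Ω) := by
  refine ⟨0, fun φ i => ?_, fun ε hε => ⟨0, ?_, fun i => ?_⟩⟩
  · have h := pair_smul (Ω := Ω) 0 0 (partialDeriv i φ)
    have h' := pair_smul (Ω := Ω) 0 0 φ
    rw [zero_smul, zero_mul] at h h'
    rw [h, Pi.zero_apply, h', neg_zero]
  · refine lt_of_eq_of_lt ((eLpNorm_congr_ae ?_).trans eLpNorm_zero) hε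
    filter_upwards [Lp.coeFn_zero ℂ 2 (volume.restrict (Ω : Set (EuclideanSpace ℝ (Fin d))))]
      with x hx
    rw [hx]
    exact sub_self (0 : ℂ)
  · refine lt_of_eq_of_lt ((eLpNorm_congr_ae ?_).trans eLpNorm_zero) hε
    filter_upwards [Lp.coeFn_zero ℂ 2 (volume.restrict (Ω : Set (EuclideanSpace ℝ (Fin d))))]
      with x hx
    have h0 : ((0 : 𝓓(Ω, ℂ)) : EuclideanSpace ℝ (Fin d) → ℂ) = fun _ => 0 := by
      ext; simp
    have hd : partialDeriv i ((0 : 𝓓(Ω, ℂ)) : _ → ℂ) x = 0 := by simp [partialDeriv, h0]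
    rw [hd, Pi.zero_apply, hx]
    exact sub_self (0 : ℂ)

lemma MemH10.add {u v : L2 Ω} (hu : MemH10 u) (hv : MemH10 v) : MemH10 (u + v) := by
  obtain ⟨g, hg, hga⟩ := hu
  obtain ⟨h, hh, hha⟩ := hv
  refine ⟨g + h, fun φ i => ?_, fun ε hε => ?_⟩
  · rw [pair_add u v (continuous_partialDeriv φ i) (hasCompactSupport_partialDeriv φ i),
      Pi.add_apply, pair_add _ _ φ.continuous φ.hasCompactSupport, hg φ i, hh φ i, neg_add]
  · obtain ⟨φ, h1, h2⟩ := hga (ε / 2) (ENNReal.half_pos hε.ne')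
    obtain ⟨ψ, h3, h4⟩ := hha (ε / 2) (ENNReal.half_pos hε.ne')
    refine ⟨φ + ψ, ?_, fun i => ?_⟩
    · refine lt_of_le_of_lt ?_ ((ENNReal.add_lt_add h1 h3).trans_eq (ENNReal.add_halves ε))
      refine le_trans (le_of_eq (eLpNorm_congr_ae ?_)) (eLpNorm_add_le
        ((Lp.aestronglyMeasurable u).sub φ.continuous.aestronglyMeasurable)
        ((Lp.aestronglyMeasurable v).sub ψ.continuous.aestronglyMeasurable) (by norm_num))
      filter_upwards [Lp.coeFn_add u v] with x hx
      rw [hx]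
      exact add_sub_add_comm (u x) (v x) (φ x) (ψ x)
    · refine lt_of_le_of_lt ?_ ((ENNReal.add_lt_add (h2 i) (h4 i)).trans_eq (ENNReal.add_halves ε))
      refine le_trans (le_of_eq (eLpNorm_congr_ae ?_)) (eLpNorm_add_le
        ((Lp.aestronglyMeasurable (g i)).sub (continuous_partialDeriv φ i).aestronglyMeasurable)
        ((Lp.aestronglyMeasurable (h i)).sub (continuous_partialDeriv ψ i).aestronglyMeasurable)
        (by norm_num))
      filter_upwards [Lp.coeFn_add (g i) (h i)] with x hx
      have hd : partialDeriv i ((φ + ψ : 𝓓(Ω, ℂ)) : _ → ℂ) x =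
          partialDeriv i φ x + partialDeriv i ψ x := by
        have e : ((φ + ψ : 𝓓(Ω, ℂ)) : EuclideanSpace ℝ (Fin d) → ℂ) = (φ : _ → ℂ) + ψ := by
          ext; simp
        rw [partialDeriv, e, fderiv_add (φ.contDiff.differentiable (by simp) x)
          (ψ.contDiff.differentiable (by simp) x)]
        rfl
      simp only [Pi.add_apply, hx, hd]
      ring

lemma MemH10.smul {u : L2 Ω} (c : ℂ) (hu : MemH10 u) : MemH10 (c • u) := by
  by_cases hc : c = 0
  · rw [hc, zero_smul]
    exact MemH10.zero
  obtain ⟨g, hg, hga⟩ := hu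
  have hc0 : (‖c‖ₑ : ℝ≥0∞) ≠ 0 := by simpa using hc
  refine ⟨c • g, fun φ i => ?_, fun ε hε => ?_⟩
  · rw [pair_smul, Pi.smul_apply, pair_smul, hg φ i, mul_neg]
  · obtain ⟨φ, h1, h2⟩ := hga (ε / ‖c‖ₑ) (ENNReal.div_pos hε.ne' (by simp))
    have hlt : ∀ {a : ℝ≥0∞}, a < ε / ‖c‖ₑ → ‖c‖ₑ * a < ε := fun {a} ha => by
      rw [mul_comm]
      exact (ENNReal.lt_div_iff_mul_lt (Or.inl hc0) (Or.inl (by simp))).mp ha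
    refine ⟨c • φ, ?_, fun i => ?_⟩
    · refine lt_of_eq_of_lt ?_ (hlt h1)
      rw [← eLpNorm_const_smul]
      refine eLpNorm_congr_ae ?_
      filter_upwards [Lp.coeFn_smul c u] with x hx
      rw [hx]
      exact (mul_sub c (u x) (φ x)).symm
    · refine lt_of_eq_of_lt ?_ (hlt (h2 i))
      rw [← eLpNorm_const_smul]
      refine eLpNorm_congr_ae ?_
      filter_upwards [Lp.coeFn_smul c (g i)] with x hx
      have hd : partialDeriv i ((c • φ : 𝓓(Ω, ℂ)) : _ → ℂ) x = c * partialDeriv i φ x := by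
        have e : ((c • φ : 𝓓(Ω, ℂ)) : EuclideanSpace ℝ (Fin d) → ℂ) = c • (φ : _ → ℂ) := by
          ext; simp
        rw [partialDeriv, e, fderiv_const_smul (φ.contDiff.differentiable (by simp) x)]
        rfl
      simp only [Pi.smul_apply, hx, hd, smul_eq_mul]
      ring

lemma IsWeakLaplacian.zero : IsWeakLaplacian (0 : L2 Ω) 0 := fun φ => by
  have h := pair_smul (Ω := Ω) 0 0 (Laplacian.laplacian (φ : _ → ℂ))
  have h' := pair_smul (Ω := Ω) 0 0 φ
  rw [zero_smul, zero_mul] at h h'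
  rw [h, h']

variable (Ω)

/-- The domain `{u ∈ H¹₀(Ω) : Δu ∈ L²(Ω)}` of the Dirichlet Laplacian. -/
def dirichletDomain : Submodule ℂ (L2 Ω) where
  carrier := {u | MemH10 u ∧ ∃ f, IsWeakLaplacian u f}
  add_mem' := fun ⟨hu, f, hf⟩ ⟨hv, g, hg⟩ => ⟨hu.add hv, f + g, hf.add hg⟩
  zero_mem' := ⟨MemH10.zero, 0, IsWeakLaplacian.zero⟩
  smul_mem' := fun c _ ⟨hu, f, hf⟩ => ⟨hu.smul c, c • f, hf.smul c⟩

variable {Ω}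

/-- The distributional Laplacian `Δu ∈ L²(Ω)` of an element of the domain. -/
def weakLaplacian (u : dirichletDomain Ω) : L2 Ω := u.2.2.choose

lemma weakLaplacian_spec (u : dirichletDomain Ω) : IsWeakLaplacian (u : L2 Ω) (weakLaplacian u) :=
  u.2.2.choose_spec

variable (Ω)

/-- The positive Dirichlet Laplacian `u ↦ -Δu` of `Ω`, as an unbounded operator in `L²(Ω)`. -/
def dirichletLaplacian : L2 Ω →ₗ.[ℂ] L2 Ω where
  domain := dirichletDomain Ω
  toFun :=
    { toFun := fun u => -weakLaplacian u
      map_add' := fun u v => by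
        rw [← neg_add, neg_inj]
        exact (weakLaplacian_spec (u + v)).unique
          ((weakLaplacian_spec u).add (weakLaplacian_spec v))
      map_smul' := fun c u => by
        rw [smul_neg, neg_inj]
        exact (weakLaplacian_spec (c • u)).unique ((weakLaplacian_spec u).smul c) }

variable {Ω}

/-- The graph of the Dirichlet Laplacian: `u` is in the domain and has image `f` if and only if
`u ∈ H¹₀(Ω)` and `-Δu = f` in the sense of distributions. -/
lemma mem_graph_dirichletLaplacian {u f : L2 Ω} :
    (u, f) ∈ (dirichletLaplacian Ω).graph ↔ MemH10 u ∧ IsWeakLaplacian u (-f) := by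
  rw [LinearPMap.mem_graph_iff]
  constructor
  · rintro ⟨y, rfl, rfl⟩
    refine ⟨y.2.1, ?_⟩
    change IsWeakLaplacian _ (-(-weakLaplacian y))
    rw [neg_neg]
    exact weakLaplacian_spec y
  · rintro ⟨hu, hf⟩
    refine ⟨⟨u, hu, -f, hf⟩, rfl, ?_⟩
    change -weakLaplacian ⟨u, hu, -f, hf⟩ = f
    rw [neg_eq_iff_eq_neg]
    exact (weakLaplacian_spec _).unique hf

end Dirichlet

/-! ### The broken guide -/

/-- The broken guide `Ω_θ` with half-opening `θ`: the points `(x₁, x₂)` of the plane such that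
`x₁ tan θ < |x₂| < (x₁ + π / sin θ) tan θ`. -/
def brokenGuide (θ : ℝ) : Opens (EuclideanSpace ℝ (Fin 2)) where
  carrier := {x | x 0 * Real.tan θ < |x 1| ∧
    |x 1| < (x 0 + Real.pi / Real.sin θ) * Real.tan θ}
  is_open' := by
    simp only [Set.ofPred_and]
    exact IsOpen.inter (isOpen_lt (by fun_prop) (by fun_prop)) (isOpen_lt (by fun_prop) (by fun_prop))

end BrokenGuide

end

/-!
The resolvent `R = (-Δ + 1)⁻¹` is a bounded self-adjoint operator, and `-Δ - z` is Fredholm exactly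
when `1 - (z + 1) R` is.

For `z ∉ [1, ∞)`: outside of a bounded set the guide consists of two half-strips of width `π`, on
which the Dirichlet inequality `∫ |w|² ≤ ∫ |w'|²` of the cross section `(0, π)` gives
`‖u‖² ≤ ‖∇u‖²`. On the bounded set, `‖u‖²` is at most a small multiple of `‖∇u‖²` as soon as the
means of `u` over finitely many small cubes vanish. So `c ‖u‖² ≤ ‖∇u‖²` holds for every `c < 1` on a
closed subspace of finite codimension, which bounds `1 - (z + 1) R` from below on such a subspace.

For `z = 1 + k²`: in the coordinates `(s, t)` along and across one arm, the wave packets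
`R^(-1/2) χ(s / R) exp(iks) sin t` with `R → ∞` through powers of `2` have disjoint supports and
constant norm, and `(-Δ - z)` maps them to a sequence converging to `0`.
-/

noncomputable section

namespace BrokenGuide

section Fredholm

open Filter Topology

lemma finiteDimensional_ker_of_norm_le {𝕜 E G : Type*} [NontriviallyNormedField 𝕜]
    [NormedAddCommGroup E] [NormedSpace 𝕜 E] [NormedAddCommGroup G] [NormedSpace 𝕜 G]
    (T : E →L[𝕜] G) (S : Submodule 𝕜 E) [S.CoFG] {C : ℝ} (h : ∀ x ∈ S, ‖x‖ ≤ C * ‖T x‖) :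
    FiniteDimensional 𝕜 T.ker := by
  refine Module.Finite.iff_fg.mpr (Submodule.CoFG.fg_of_disjoint (T := S) ?_ ‹_›)
  refine Submodule.disjoint_def.mpr fun x hx hxS => norm_le_zero_iff.mp ?_
  have hTx : T x = 0 := hx
  simpa only [hTx, norm_zero, mul_zero] using h x hxS

lemma isClosed_range_of_norm_le {𝕜 E G : Type*} [NontriviallyNormedField 𝕜] [CompleteSpace 𝕜]
    [NormedAddCommGroup E] [NormedSpace 𝕜 E] [CompleteSpace E] [NormedAddCommGroup G]
    [NormedSpace 𝕜 G] (T : E →L[𝕜] G) {S : Submodule 𝕜 E} [S.CoFG] (hS : IsClosed (S : Set E))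
    {C : ℝ} (h : ∀ x ∈ S, ‖x‖ ≤ C * ‖T x‖) :
    IsClosed (T.range : Set G) := by
  have := hS.completeSpace_coe
  have hT : AntilipschitzWith C.toNNReal (T ∘L S.subtypeL) :=
    (T ∘L S.subtypeL).antilipschitz_of_bound fun x =>
      (h x x.2).trans (mul_le_mul_of_nonneg_right C.le_coe_toNNReal (norm_nonneg _))
  have himage : (T ∘L S.subtypeL).range = S.map (T : E →ₗ[𝕜] G) := by
    rw [ContinuousLinearMap.toLinearMap_comp, LinearMap.range_comp]
    exact congrArg _ S.range_subtype
  refine LinearMap.isClosed_range_of_isClosed_map_of_finiteDimensional_quotient (s := S) ?_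
  rw [← himage]
  exact hT.isClosed_range (T ∘L S.subtypeL).uniformContinuous

variable {H : Type*} [NormedAddCommGroup H] [InnerProductSpace ℂ H]

lemma isFredholm_comp_equiv_iff {D D' : Type*} [AddCommGroup D] [Module ℂ D] [AddCommGroup D']
    [Module ℂ D'] (T : D →ₗ[ℂ] H) (e : D' ≃ₗ[ℂ] D) :
    IsFredholm (T ∘ₗ (e : D' →ₗ[ℂ] D)) ↔ IsFredholm T := by
  have hrange : LinearMap.range (T ∘ₗ (e : D' →ₗ[ℂ] D)) = LinearMap.range T :=
    LinearMap.range_comp_of_range_eq_top _ e.range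
  have hker : LinearMap.ker (T ∘ₗ (e : D' →ₗ[ℂ] D)) ≃ₗ[ℂ] LinearMap.ker T := by
    rw [LinearMap.ker_comp]
    exact LinearEquiv.ofSubmodule' e (LinearMap.ker T)
  exact ⟨fun ⟨h₁, h₂, h₃⟩ => ⟨hker.finiteDimensional, hrange ▸ h₂, hrange ▸ h₃⟩,
    fun ⟨h₁, h₂, h₃⟩ => ⟨hker.symm.finiteDimensional, hrange ▸ h₂, hrange ▸ h₃⟩⟩

lemma isFredholm_of_finiteDimensional_ker_adjoint [CompleteSpace H] {T : H →L[ℂ] H}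
    (hker : FiniteDimensional ℂ T.ker) (hrange : IsClosed (T.range : Set H))
    (hadj : FiniteDimensional ℂ T.adjoint.ker) : IsFredholm (T : H →ₗ[ℂ] H) := by
  have := hrange.completeSpace_coe
  rw [← T.orthogonal_range] at hadj
  exact ⟨hker, hrange, (Submodule.FG.cofg_of_isCompl T.range.isCompl_orthogonal.symm
    (Module.Finite.iff_fg.mp hadj))⟩

lemma abs_im_mul_norm_le {R : H →L[ℂ] H} (hR : R.IsSymmetric) (w : ℂ) (f : H) :
    |w.im| * ‖R f‖ ≤ ‖(1 - w • R) f‖ := by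
  have him : (inner ℂ (R f) ((1 - w • R) f)).im = -(w.im * ‖R f‖ ^ 2) := by
    have h : (inner ℂ (R f) f).im = 0 := hR.im_inner_apply_self f
    simp [h, inner_self_eq_norm_sq_to_K, ← Complex.ofReal_pow]
  have hcs := (Complex.abs_im_le_norm _).trans (norm_inner_le_norm (𝕜 := ℂ) (R f) ((1 - w • R) f))
  rw [him, abs_neg, abs_mul, abs_of_nonneg (sq_nonneg ‖R f‖)] at hcs
  rcases (norm_nonneg (R f)).eq_or_lt with h | h
  · rw [← h, mul_zero]
    exact norm_nonneg _
  · exact le_of_mul_le_mul_right (by linarith) h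

lemma sub_re_mul_norm_le {R : H →L[ℂ] H} {c : ℝ} {f : H}
    (hf : c * ‖R f‖ ^ 2 ≤ (inner ℂ (R f) f).re) {w : ℂ} :
    (c - w.re) * ‖R f‖ ≤ ‖(1 - w • R) f‖ := by
  have hre : (inner ℂ (R f) ((1 - w • R) f)).re = (inner ℂ (R f) f).re - w.re * ‖R f‖ ^ 2 := by
    simp [inner_self_eq_norm_sq_to_K, ← Complex.ofReal_pow]
  have hcs := (Complex.re_le_norm _).trans (norm_inner_le_norm (𝕜 := ℂ) (R f) ((1 - w • R) f))
  rcases (norm_nonneg (R f)).eq_or_lt with h | h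
  · rw [← h, mul_zero]
    exact norm_nonneg _
  · exact le_of_mul_le_mul_right (by linarith) h

lemma norm_le_of_norm_apply_le {R : H →L[ℂ] H} {w : ℂ} {f : H} {δ : ℝ} (hδ : 0 < δ)
    (h : δ * ‖R f‖ ≤ ‖(1 - w • R) f‖) : ‖f‖ ≤ (1 + ‖w‖ / δ) * ‖(1 - w • R) f‖ := by
  have hRf : ‖R f‖ ≤ ‖(1 - w • R) f‖ / δ := (le_div_iff₀' hδ).mpr h
  calc ‖f‖ = ‖(1 - w • R) f + w • R f‖ := by simp
    _ ≤ ‖(1 - w • R) f‖ + ‖w‖ * ‖R f‖ := (norm_add_le _ _).trans_eq (by rw [norm_smul])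
    _ ≤ ‖(1 - w • R) f‖ + ‖w‖ * (‖(1 - w • R) f‖ / δ) := by gcongr
    _ = (1 + ‖w‖ / δ) * ‖(1 - w • R) f‖ := by ring

lemma exists_norm_le_of_notMem_Ici {R : H →L[ℂ] H} (hR : R.IsSymmetric) {S : Submodule ℂ H}
    {c : ℝ} (hS : ∀ f, R f ∈ S → c * ‖R f‖ ^ 2 ≤ (inner ℂ (R f) f).re) {w : ℂ}
    (hw : w ∉ Complex.ofReal '' Set.Ici c) :
    ∃ C, ∀ f ∈ S.comap (R : H →ₗ[ℂ] H), ‖f‖ ≤ C * ‖(1 - w • R) f‖ := by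
  by_cases him : w.im = 0
  · have hre : w.re < c := by
      by_contra! h
      exact hw ⟨w.re, h, Complex.ext rfl him.symm⟩
    exact ⟨_, fun f hf => norm_le_of_norm_apply_le (sub_pos.mpr hre)
      (sub_re_mul_norm_le (hS f hf))⟩
  · exact ⟨_, fun f _ => norm_le_of_norm_apply_le (abs_pos.mpr him) (abs_im_mul_norm_le hR w f)⟩

lemma isFredholm_one_sub_smul [CompleteSpace H] {R : H →L[ℂ] H} (hR : IsSelfAdjoint R)
    {S : Submodule ℂ H} (hSc : IsClosed (S : Set H)) [S.CoFG] {c : ℝ}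
    (hS : ∀ f, R f ∈ S → c * ‖R f‖ ^ 2 ≤ (inner ℂ (R f) f).re) {w : ℂ}
    (hw : w ∉ Complex.ofReal '' Set.Ici c) :
    IsFredholm ((1 - w • R : H →L[ℂ] H) : H →ₗ[ℂ] H) := by
  have hw' : starRingEnd ℂ w ∉ Complex.ofReal '' Set.Ici c := by
    rintro ⟨r, hr, h⟩
    exact hw ⟨r, hr, by rw [← Complex.conj_conj w, ← h, Complex.conj_ofReal]⟩
  have hadj : (1 - w • R).adjoint = 1 - starRingEnd ℂ w • R := by
    rw [← ContinuousLinearMap.star_eq_adjoint, star_sub, star_smul, star_one, hR.star_eq]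
    rfl
  have hclosed : IsClosed (S.comap (R : H →ₗ[ℂ] H) : Set H) := hSc.preimage R.continuous
  have hcofinite : (S.comap (R : H →ₗ[ℂ] H)).CoFG := by
    rw [← S.ker_mkQ, ← LinearMap.ker_comp]
    exact Submodule.CoFG.ker _
  obtain ⟨C, hC⟩ := exists_norm_le_of_notMem_Ici hR.isSymmetric hS hw
  obtain ⟨C', hC'⟩ := exists_norm_le_of_notMem_Ici hR.isSymmetric hS hw'
  refine isFredholm_of_finiteDimensional_ker_adjoint (finiteDimensional_ker_of_norm_le _ _ hC)
    (isClosed_range_of_norm_le _ hclosed hC) ?_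
  rw [hadj]
  exact finiteDimensional_ker_of_norm_le _ _ hC'

lemma exists_tendsto_subseq_of_isFredholm [CompleteSpace H] {T : H →L[ℂ] H}
    (hT : IsFredholm (T : H →ₗ[ℂ] H)) {f : ℕ → H} {M : ℝ} (hf : ∀ n, ‖f n‖ ≤ M)
    (hTf : Tendsto (fun n => T (f n)) atTop (𝓝 0)) :
    ∃ a, ∃ φ : ℕ → ℕ, StrictMono φ ∧ Tendsto (f ∘ φ) atTop (𝓝 a) := by
  have := hT.finite_ker
  have := hT.isClosed_range.completeSpace_coe
  have : ProperSpace T.ker := FiniteDimensional.proper ℂ _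
  obtain ⟨C, -, hC⟩ := T.rangeRestrict.exists_preimage_norm_le
    (LinearMap.surjective_rangeRestrict (T : H →ₗ[ℂ] H))
  choose w hTw hw using fun n => hC ⟨T (f n), f n, rfl⟩
  have hw0 : Tendsto w atTop (𝓝 0) :=
    squeeze_zero_norm hw (by simpa using hTf.norm.const_mul C)
  obtain ⟨M', hM'⟩ := hw0.norm.bddAbove_range
  let k : ℕ → T.ker := fun n =>
    ⟨f n - w n, by simpa [sub_eq_zero] using (congrArg Subtype.val (hTw n)).symm⟩
  have hk : ∀ n, k n ∈ Metric.closedBall 0 (M + M') := fun n =>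
    mem_closedBall_zero_iff.mpr
      ((norm_sub_le _ _).trans (add_le_add (hf n) (hM' (Set.mem_range_self n))))
  obtain ⟨a, -, φ, hφ, hlim⟩ := tendsto_subseq_of_bounded Metric.isBounded_closedBall hk
  refine ⟨a, φ, hφ, ?_⟩
  have hsum := ((continuous_subtype_val.tendsto a).comp hlim).add (hw0.comp hφ.tendsto_atTop)
  simpa [k, Function.comp_def] using hsum

/-- `R` is the resolvent `(A + 1)⁻¹` of the unbounded operator `A`, expressed on the graph of `A` so
as to contain the description of its domain. -/
def IsInvAddOne (A : H →ₗ.[ℂ] H) (R : H →L[ℂ] H) : Prop :=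
  ∀ u f, (u, f) ∈ A.graph ↔ R (f + u) = u

namespace IsInvAddOne

variable {A : H →ₗ.[ℂ] H} {R : H →L[ℂ] H}

lemma mem_graph (h : IsInvAddOne A R) (f : H) : (R f, f - R f) ∈ A.graph :=
  (h _ _).mpr (by rw [sub_add_cancel])

lemma exists_linearEquiv (h : IsInvAddOne A R) :
    ∃ e : H ≃ₗ[ℂ] A.domain, ∀ f, (e f : H) = R f ∧ A (e f) = f - R f := by
  let r : H →ₗ[ℂ] A.domain := (R : H →ₗ[ℂ] H).codRestrict A.domain fun f =>
    LinearPMap.mem_domain_of_mem_graph (h.mem_graph f)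
  have hr : ∀ f, A (r f) = f - R f := fun f =>
    LinearPMap.mem_graph_snd_inj A (A.mem_graph (r f)) (h.mem_graph f) rfl
  have hinj : Function.Injective r := fun f g hfg => by
    have hR : R f = R g := congrArg Subtype.val hfg
    have hA := (hr f).symm.trans ((congrArg A hfg).trans (hr g))
    rwa [hR, sub_left_inj] at hA
  have hsurj : Function.Surjective r := fun u =>
    ⟨A u + u, Subtype.ext ((h _ _).mp (A.mem_graph u))⟩
  exact ⟨LinearEquiv.ofBijective r ⟨hinj, hsurj⟩, fun f => ⟨rfl, hr f⟩⟩

lemma isFredholm_subScalar_iff (h : IsInvAddOne A R) (z : ℂ) :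
    IsFredholm (subScalar A z) ↔ IsFredholm ((1 - (z + 1) • R : H →L[ℂ] H) : H →ₗ[ℂ] H) := by
  obtain ⟨e, he⟩ := h.exists_linearEquiv
  have hcomp : subScalar A z ∘ₗ (e : H →ₗ[ℂ] A.domain) =
      ((1 - (z + 1) • R : H →L[ℂ] H) : H →ₗ[ℂ] H) := by
    ext f
    change A (e f) - z • (e f : H) = f - (z + 1) • R f
    rw [(he f).1, (he f).2, add_smul, one_smul]
    abel
  rw [← hcomp, isFredholm_comp_equiv_iff]

lemma isFredholm_subScalar [CompleteSpace H] (h : IsInvAddOne A R) (hR : IsSelfAdjoint R)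
    {S : Submodule ℂ H} (hSc : IsClosed (S : Set H)) [S.CoFG] {c : ℝ}
    (hS : ∀ f, R f ∈ S → (c + 1) * ‖R f‖ ^ 2 ≤ (inner ℂ (R f) f).re) {z : ℂ}
    (hz : z ∉ Complex.ofReal '' Set.Ici c) : IsFredholm (subScalar A z) := by
  refine (h.isFredholm_subScalar_iff z).mpr (isFredholm_one_sub_smul hR hSc hS ?_)
  rintro ⟨r, hr, hrz⟩
  exact hz ⟨r - 1, Set.mem_Ici.mpr (le_sub_iff_add_le.mpr hr), by simp [hrz]⟩

lemma not_isFredholm_subScalar_of_separated [CompleteSpace H] (h : IsInvAddOne A R) {z : ℂ}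
    {u g : ℕ → H} (hu : ∀ n, (u n, g n) ∈ A.graph) {M c : ℝ} (hM : ∀ n, ‖u n‖ ≤ M) (hc : 0 < c)
    (hsep : Pairwise fun n m => c ≤ ‖u n - u m‖)
    (hlim : Tendsto (fun n => g n - z • u n) atTop (𝓝 0)) :
    ¬ IsFredholm (subScalar A z) := by
  rw [h.isFredholm_subScalar_iff]
  intro hF
  have hR : ∀ n, R (g n + u n) = u n := fun n => (h _ _).mp (hu n)
  have hT : ∀ n, (1 - (z + 1) • R) (g n + u n) = g n - z • u n := fun n => by
    change g n + u n - (z + 1) • R (g n + u n) = _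
    rw [hR, add_smul, one_smul]
    abel
  obtain ⟨M', hM'⟩ := hlim.norm.bddAbove_range
  have hbound : ∀ n, ‖g n + u n‖ ≤ M' + ‖z + 1‖ * M := fun n => by
    calc ‖g n + u n‖ = ‖(g n - z • u n) + (z + 1) • u n‖ := by
          rw [add_smul, one_smul]
          abel_nf
      _ ≤ ‖g n - z • u n‖ + ‖z + 1‖ * ‖u n‖ := (norm_add_le _ _).trans_eq (by rw [norm_smul])
      _ ≤ M' + ‖z + 1‖ * M := by
          gcongr
          exacts [hM' (Set.mem_range_self n), hM n]
  obtain ⟨a, φ, hφ, hconv⟩ :=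
    exists_tendsto_subseq_of_isFredholm hF hbound (hlim.congr fun n => (hT n).symm)
  have hcauchy : CauchySeq (u ∘ φ) :=
    (((R.continuous.tendsto a).comp hconv).congr fun n => hR (φ n)).cauchySeq
  obtain ⟨N, hN⟩ := Metric.cauchySeq_iff.mp hcauchy c hc
  have hlt := hN N le_rfl (N + 1) N.le_succ
  rw [dist_eq_norm] at hlt
  exact (hsep (hφ.injective.ne N.succ_ne_self.symm)).not_gt hlt

end IsInvAddOne

end Fredholm

section Calculus

variable {d : ℕ} {Ω : Opens (EuclideanSpace ℝ (Fin d))}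

lemma contDiff_partialDeriv {f : EuclideanSpace ℝ (Fin d) → ℂ} (hf : ContDiff ℝ ∞ f) (i : Fin d) :
    ContDiff ℝ ∞ (partialDeriv i f) :=
  (hf.fderiv_right (m := ∞) (by simp)).clm_apply contDiff_const

lemma tsupport_partialDeriv_subset (f : EuclideanSpace ℝ (Fin d) → ℂ) (i : Fin d) :
    tsupport (partialDeriv i f) ⊆ tsupport f :=
  tsupport_fderiv_apply_subset ℝ _

/-- The partial derivative of a test function, as a test function. -/
def partialTest (i : Fin d) (φ : 𝓓(Ω, ℂ)) : 𝓓(Ω, ℂ) where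
  toFun := partialDeriv i φ
  contDiff' := contDiff_partialDeriv φ.contDiff i
  hasCompactSupport' := hasCompactSupport_partialDeriv φ i
  tsupport_subset' := (tsupport_partialDeriv_subset _ i).trans φ.tsupport_subset

lemma coe_partialTest (i : Fin d) (φ : 𝓓(Ω, ℂ)) : (partialTest i φ : _ → ℂ) = partialDeriv i φ :=
  rfl

/-- The complex conjugate of a test function. -/
def conjTest (φ : 𝓓(Ω, ℂ)) : 𝓓(Ω, ℂ) where
  toFun := fun x => starRingEnd ℂ (φ x)
  contDiff' := Complex.conjCLE.contDiff.comp φ.contDiff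
  hasCompactSupport' := φ.hasCompactSupport.comp_left (g := starRingEnd ℂ) (map_zero _)
  tsupport_subset' :=
    (closure_mono (Function.support_comp_subset (map_zero (starRingEnd ℂ)) φ)).trans
      φ.tsupport_subset

lemma conjTest_apply (φ : 𝓓(Ω, ℂ)) (x : EuclideanSpace ℝ (Fin d)) :
    conjTest φ x = starRingEnd ℂ (φ x) := rfl

lemma conjTest_involutive : Function.Involutive (conjTest (Ω := Ω)) := fun φ => by
  ext x
  simp [conjTest_apply]

lemma partialDeriv_conjTest (φ : 𝓓(Ω, ℂ)) (i : Fin d) (x : EuclideanSpace ℝ (Fin d)) :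
    partialDeriv i (conjTest φ) x = starRingEnd ℂ (partialDeriv i φ x) := by
  change fderiv ℝ (Complex.conjCLE ∘ φ) x _ = _
  rw [Complex.conjCLE.comp_fderiv]
  rfl

lemma laplacian_eq_sum_fderiv (b : OrthonormalBasis (Fin d) ℝ (EuclideanSpace ℝ (Fin d)))
    {f : EuclideanSpace ℝ (Fin d) → ℂ} (hf : ContDiff ℝ ∞ f) (x : EuclideanSpace ℝ (Fin d)) :
    Laplacian.laplacian f x = ∑ i, fderiv ℝ (fun y => fderiv ℝ f y (b i)) x (b i) := by
  rw [InnerProductSpace.laplacian_eq_iteratedFDeriv_orthonormalBasis f b]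
  refine Finset.sum_congr rfl fun i _ => ?_
  have hd : DifferentiableAt ℝ (fderiv ℝ f) x :=
    ((hf.fderiv_right (m := ∞) (by simp)).differentiable (by simp)) x
  rw [iteratedFDeriv_two_apply, fderiv_clm_apply hd (differentiableAt_const _)]
  simp

lemma laplacian_eq_sum_partialDeriv {f : EuclideanSpace ℝ (Fin d) → ℂ} (hf : ContDiff ℝ ∞ f)
    (x : EuclideanSpace ℝ (Fin d)) :
    Laplacian.laplacian f x = ∑ i, partialDeriv i (partialDeriv i f) x := by
  rw [laplacian_eq_sum_fderiv (EuclideanSpace.basisFun (Fin d) ℝ) hf]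
  simp only [EuclideanSpace.basisFun_apply]
  rfl

lemma setIntegral_mul_testFunction (a : EuclideanSpace ℝ (Fin d) → ℂ) (φ : 𝓓(Ω, ℂ)) :
    ∫ x in (Ω : Set (EuclideanSpace ℝ (Fin d))), a x * φ x = ∫ x, a x * φ x :=
  setIntegral_eq_integral_of_forall_compl_eq_zero fun x hx => by
    rw [image_eq_zero_of_notMem_tsupport (fun h => hx (φ.tsupport_subset h)), mul_zero]

lemma integral_mul_partialDeriv_testFunction {a : EuclideanSpace ℝ (Fin d) → ℂ}
    (ha : ContDiff ℝ ∞ a) (φ : 𝓓(Ω, ℂ)) (i : Fin d) :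
    ∫ x in (Ω : Set (EuclideanSpace ℝ (Fin d))), a x * partialDeriv i φ x =
      - ∫ x in (Ω : Set (EuclideanSpace ℝ (Fin d))), partialDeriv i a x * φ x := by
  rw [← coe_partialTest, setIntegral_mul_testFunction, setIntegral_mul_testFunction]
  refine integral_mul_fderiv_eq_neg_fderiv_mul_of_integrable ?_ ?_ ?_
    (fun x _ => ha.differentiable (by simp) x) (fun x _ => φ.contDiff.differentiable (by simp) x)
  · exact ((contDiff_partialDeriv ha i).continuous.mul φ.continuous).integrable_of_hasCompactSupport
      φ.hasCompactSupport.mul_left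
  · exact (ha.continuous.mul (continuous_partialDeriv φ i)).integrable_of_hasCompactSupport
      (hasCompactSupport_partialDeriv φ i).mul_left
  · exact (ha.continuous.mul φ.continuous).integrable_of_hasCompactSupport
      φ.hasCompactSupport.mul_left

lemma integral_mul_laplacian_testFunction {a : EuclideanSpace ℝ (Fin d) → ℂ} (ha : ContDiff ℝ ∞ a)
    (φ : 𝓓(Ω, ℂ)) :
    ∫ x in (Ω : Set (EuclideanSpace ℝ (Fin d))), a x * Laplacian.laplacian (φ : _ → ℂ) x =
      ∫ x in (Ω : Set (EuclideanSpace ℝ (Fin d))), Laplacian.laplacian a x * φ x := by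
  simp_rw [laplacian_eq_sum_partialDeriv ha, laplacian_eq_sum_partialDeriv φ.contDiff,
    Finset.mul_sum, Finset.sum_mul]
  rw [integral_finsetSum, integral_finsetSum]
  · refine Finset.sum_congr rfl fun i _ => ?_
    exact (integral_mul_partialDeriv_testFunction ha (partialTest i φ) i).trans
      (neg_eq_iff_eq_neg.mpr
        (integral_mul_partialDeriv_testFunction (contDiff_partialDeriv ha i) φ i))
  · intro i _
    exact (((contDiff_partialDeriv (contDiff_partialDeriv ha i) i).continuous.mul
      φ.continuous).integrable_of_hasCompactSupport φ.hasCompactSupport.mul_left).integrableOn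
  · intro i _
    exact ((ha.continuous.mul (partialTest i (partialTest i φ)).continuous
      ).integrable_of_hasCompactSupport
      (partialTest i (partialTest i φ)).hasCompactSupport.mul_left).integrableOn

lemma IsWeakGradient.integral_mul_laplacian {u : L2 Ω} {g : Fin d → L2 Ω}
    (h : IsWeakGradient u g) (φ : 𝓓(Ω, ℂ)) :
    ∫ x in (Ω : Set (EuclideanSpace ℝ (Fin d))), u x * Laplacian.laplacian (φ : _ → ℂ) x =
      - ∑ i, ∫ x in (Ω : Set (EuclideanSpace ℝ (Fin d))), g i x * partialDeriv i φ x := by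
  simp_rw [laplacian_eq_sum_partialDeriv φ.contDiff, Finset.mul_sum]
  rw [integral_finsetSum, ← Finset.sum_neg_distrib]
  · exact Finset.sum_congr rfl fun i _ => h (partialTest i φ) i
  · intro i _
    exact integrable_pair u (partialTest i (partialTest i φ)).continuous
      (partialTest i (partialTest i φ)).hasCompactSupport

end Calculus

section Resolvent

variable {d : ℕ} {Ω : Opens (EuclideanSpace ℝ (Fin d))}

/-- The class in `L²(Ω)` of a continuous function with compact support. -/
def contL2 (Ω : Opens (EuclideanSpace ℝ (Fin d))) {ψ : EuclideanSpace ℝ (Fin d) → ℂ}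
    (hc : Continuous ψ) (hs : HasCompactSupport ψ) : L2 Ω :=
  (hc.memLp_of_hasCompactSupport hs).toLp ψ

lemma coeFn_contL2 {ψ : EuclideanSpace ℝ (Fin d) → ℂ} (hc : Continuous ψ)
    (hs : HasCompactSupport ψ) :
    contL2 Ω hc hs =ᵐ[volume.restrict (Ω : Set (EuclideanSpace ℝ (Fin d)))] ψ :=
  MemLp.coeFn_toLp _

lemma enorm_sub_contL2 (u : L2 Ω) {ψ : EuclideanSpace ℝ (Fin d) → ℂ} (hc : Continuous ψ)
    (hs : HasCompactSupport ψ) :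
    ‖u - contL2 Ω hc hs‖ₑ =
      eLpNorm (fun x => u x - ψ x) 2 (volume.restrict (Ω : Set (EuclideanSpace ℝ (Fin d)))) := by
  rw [Lp.enorm_def]
  refine eLpNorm_congr_ae ?_
  filter_upwards [Lp.coeFn_sub u (contL2 Ω hc hs), coeFn_contL2 (Ω := Ω) hc hs] with x hsub hψ
  rw [hsub, Pi.sub_apply, hψ]

lemma inner_contL2 (u : L2 Ω) {ψ : EuclideanSpace ℝ (Fin d) → ℂ} (hc : Continuous ψ)
    (hs : HasCompactSupport ψ) :
    inner ℂ (contL2 Ω hc hs) u =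
      ∫ x in (Ω : Set (EuclideanSpace ℝ (Fin d))), u x * starRingEnd ℂ (ψ x) := by
  rw [L2.inner_def]
  refine integral_congr_ae ?_
  filter_upwards [coeFn_contL2 (Ω := Ω) hc hs] with x hψ
  rw [hψ, RCLike.inner_apply]

/-- The Hilbert space `L²(Ω)^(1+d)` of candidate pairs `(u, ∇u)`: the component `none` is `u` and
the component `some i` is `∂ᵢu`. -/
abbrev Jet (Ω : Opens (EuclideanSpace ℝ (Fin d))) : Type :=
  PiLp 2 (fun _ : Option (Fin d) => L2 Ω)

/-- The linear embedding `φ ↦ (φ, ∇φ)` of the test functions into `Jet Ω`. -/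
def testJet : 𝓓(Ω, ℂ) →ₗ[ℂ] Jet Ω where
  toFun φ := WithLp.toLp 2 fun o => o.elim (contL2 Ω φ.continuous φ.hasCompactSupport)
    fun i => contL2 Ω (continuous_partialDeriv φ i) (hasCompactSupport_partialDeriv φ i)
  map_add' φ ψ := PiLp.ext fun o => by
    cases o with
    | none => rfl
    | some i =>
      have h : partialDeriv i ⇑(φ + ψ) = partialDeriv i φ + partialDeriv i ψ :=
        funext fun x => congrArg (· (EuclideanSpace.single i 1))
          (fderiv_add (φ.contDiff.differentiable (by simp) x)
            (ψ.contDiff.differentiable (by simp) x))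
      simp only [Option.elim_some, h]
      rfl
  map_smul' c φ := PiLp.ext fun o => by
    cases o with
    | none => rfl
    | some i =>
      have h : partialDeriv i ⇑(c • φ) = c • partialDeriv i φ :=
        funext fun x => congrArg (· (EuclideanSpace.single i 1))
          (fderiv_const_smul (φ.contDiff.differentiable (by simp) x) c)
      simp only [Option.elim_some, h]
      rfl

lemma testJet_none (φ : 𝓓(Ω, ℂ)) :
    testJet φ none = contL2 Ω φ.continuous φ.hasCompactSupport := rfl

lemma testJet_some (φ : 𝓓(Ω, ℂ)) (i : Fin d) :
    testJet φ (some i) =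
      contL2 Ω (continuous_partialDeriv φ i) (hasCompactSupport_partialDeriv φ i) := rfl

/-- The Hilbert space `H¹₀(Ω)`, realised as the closure of the jets of test functions. -/
def H10 (Ω : Opens (EuclideanSpace ℝ (Fin d))) : Submodule ℂ (Jet Ω) :=
  (LinearMap.range (testJet (Ω := Ω))).topologicalClosure

lemma testJet_mem (φ : 𝓓(Ω, ℂ)) : testJet φ ∈ H10 Ω :=
  Submodule.le_topologicalClosure _ ⟨φ, rfl⟩

instance : CompleteSpace (H10 Ω) :=
  (Submodule.isClosed_topologicalClosure _).completeSpace_coe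

lemma H10_induction {p : Jet Ω → Prop} (hp : IsClosed {x | p x}) (h : ∀ φ, p (testJet φ))
    {x : Jet Ω} (hx : x ∈ H10 Ω) : p x :=
  closure_minimal (Set.range_subset_iff.mpr h) hp hx

lemma mem_H10_iff_forall_enorm_lt {x : Jet Ω} :
    x ∈ H10 Ω ↔ ∀ ε > 0, ∃ φ : 𝓓(Ω, ℂ), ∀ o, ‖x o - testJet φ o‖ₑ < ε := by
  have hclosure : closure (Set.range (testJet (Ω := Ω))) =
      WithLp.ofLp ⁻¹' closure (WithLp.ofLp '' Set.range (testJet (Ω := Ω))) :=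
    (PiLp.homeomorph 2 _).isInducing.closure_eq_preimage_closure_image _
  change x ∈ closure (Set.range testJet) ↔ _
  rw [hclosure, Set.mem_preimage, EMetric.mem_closure_iff]
  refine forall₂_congr fun ε hε => ?_
  simp only [Set.exists_mem_image, Set.exists_range_iff, edist_pi_def,
    Finset.sup_lt_iff (show ⊥ < ε from hε), Finset.mem_univ, true_imp_iff]
  simp only [edist_eq_enorm_sub]

lemma continuous_jet_apply (o : Option (Fin d)) : Continuous fun x : Jet Ω => x o :=
  PiLp.continuous_apply 2 _ o

lemma inner_jet (x y : Jet Ω) :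
    inner ℂ x y = inner ℂ (x none) (y none) + ∑ i, inner ℂ (x (some i)) (y (some i)) := by
  rw [PiLp.inner_apply, Fintype.sum_option]

lemma isWeakGradient_iff {u : L2 Ω} {g : Fin d → L2 Ω} :
    IsWeakGradient u g ↔ ∀ (φ : 𝓓(Ω, ℂ)) (i : Fin d),
      inner ℂ (testJet φ (some i)) u = -(inner ℂ (testJet φ none) (g i)) := by
  rw [IsWeakGradient, conjTest_involutive.surjective.forall]
  simp only [testJet_some, testJet_none, inner_contL2, partialDeriv_conjTest, conjTest_apply]

lemma isWeakLaplacian_iff {u f : L2 Ω} {g : Fin d → L2 Ω} (hg : IsWeakGradient u g) :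
    IsWeakLaplacian u f ↔
      ∀ φ : 𝓓(Ω, ℂ), ∑ i, inner ℂ (testJet φ (some i)) (g i) = -(inner ℂ (testJet φ none) f) := by
  rw [IsWeakLaplacian, conjTest_involutive.surjective.forall]
  simp only [hg.integral_mul_laplacian, testJet_some, testJet_none, inner_contL2,
    partialDeriv_conjTest, conjTest_apply, neg_eq_iff_eq_neg]

lemma isWeakGradient_testJet (ψ : 𝓓(Ω, ℂ)) :
    IsWeakGradient (testJet ψ none) (fun i => testJet ψ (some i)) := fun φ i => by
  have hψ := coeFn_contL2 (Ω := Ω) ψ.continuous ψ.hasCompactSupport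
  have hdψ := coeFn_contL2 (Ω := Ω) (continuous_partialDeriv ψ i)
    (hasCompactSupport_partialDeriv ψ i)
  refine (integral_congr_ae ?_).trans
    ((integral_mul_partialDeriv_testFunction ψ.contDiff φ i).trans
      (congrArg Neg.neg (integral_congr_ae ?_)))
  · filter_upwards [hψ] with x hx
    rw [testJet_none, hx]
  · filter_upwards [hdψ] with x hx
    rw [testJet_some, hx]

lemma isWeakGradient_of_mem_H10 {x : Jet Ω} (hx : x ∈ H10 Ω) :
    IsWeakGradient (x none) (fun i => x (some i)) := by
  refine isWeakGradient_iff.mpr fun φ i => H10_induction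
    (p := fun x : Jet Ω => inner ℂ (testJet φ (some i)) (x none) =
      -(inner ℂ (testJet φ none) (x (some i)))) ?_
    (fun ψ => isWeakGradient_iff.mp (isWeakGradient_testJet ψ) φ i) hx
  exact isClosed_eq (continuous_const.inner (continuous_jet_apply _))
    (continuous_const.inner (continuous_jet_apply _)).neg

lemma memH10_iff {u : L2 Ω} : MemH10 u ↔ ∃ x ∈ H10 Ω, x none = u := by
  simp only [mem_H10_iff_forall_enorm_lt, Option.forall, testJet_none, testJet_some,
    enorm_sub_contL2]
  constructor
  · rintro ⟨g, -, h⟩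
    exact ⟨WithLp.toLp 2 fun o => o.elim u g, h, rfl⟩
  · rintro ⟨x, hx, rfl⟩
    refine ⟨_, isWeakGradient_of_mem_H10 (mem_H10_iff_forall_enorm_lt.mpr ?_), hx⟩
    simpa only [Option.forall, testJet_none, testJet_some, enorm_sub_contL2] using hx

/-- The inclusion of `H¹₀(Ω)` into `L²(Ω)`. -/
def inclL2 (Ω : Opens (EuclideanSpace ℝ (Fin d))) : H10 Ω →L[ℂ] L2 Ω :=
  PiLp.proj (𝕜 := ℂ) 2 (fun _ : Option (Fin d) => L2 Ω) none ∘L (H10 Ω).subtypeL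

lemma inclL2_apply (x : H10 Ω) : inclL2 Ω x = (x : Jet Ω) none := rfl

/-- The resolvent `(-Δ + 1)⁻¹` of the Dirichlet Laplacian. It is `ι ι†` for the inclusion `ι` of
`H¹₀(Ω)` into `L²(Ω)`, because `ι† f` is the weak solution `u` of `-Δu + u = f`. -/
def resolventOp (Ω : Opens (EuclideanSpace ℝ (Fin d))) : L2 Ω →L[ℂ] L2 Ω :=
  inclL2 Ω ∘L (inclL2 Ω).adjoint

lemma isSelfAdjoint_resolventOp : IsSelfAdjoint (resolventOp Ω) :=
  (ContinuousLinearMap.isPositive_self_comp_adjoint (inclL2 Ω)).isSelfAdjoint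

lemma adjoint_inclL2_eq_iff {f : L2 Ω} {x : H10 Ω} :
    (inclL2 Ω).adjoint f = x ↔
      IsWeakLaplacian ((x : Jet Ω) none) (-(f - (x : Jet Ω) none)) := by
  rw [isWeakLaplacian_iff (isWeakGradient_of_mem_H10 x.2)]
  have hinner : ∀ φ : 𝓓(Ω, ℂ),
      ∑ i, inner ℂ (testJet φ (some i)) ((x : Jet Ω) (some i)) =
        -(inner ℂ (testJet φ none) (-(f - (x : Jet Ω) none))) ↔
      inner ℂ (testJet φ none) f = inner ℂ (testJet φ) (x : Jet Ω) := fun φ => by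
    rw [inner_jet, inner_neg_right, neg_neg, inner_sub_right, eq_sub_iff_add_eq', eq_comm]
  simp only [hinner]
  constructor
  · rintro rfl φ
    exact (ContinuousLinearMap.adjoint_inner_right (inclL2 Ω) ⟨testJet φ, testJet_mem φ⟩ f).symm
  · intro h
    refine ext_inner_left ℂ fun y => ?_
    rw [ContinuousLinearMap.adjoint_inner_right, Submodule.coe_inner, inclL2_apply]
    refine H10_induction (p := fun y : Jet Ω => inner ℂ (y none) f = inner ℂ y (x : Jet Ω)) ?_ h y.2
    exact isClosed_eq ((continuous_jet_apply _).inner continuous_const)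
      (continuous_id.inner continuous_const)

lemma isInvAddOne_resolventOp : IsInvAddOne (dirichletLaplacian Ω) (resolventOp Ω) := fun u f => by
  rw [mem_graph_dirichletLaplacian, memH10_iff]
  constructor
  · rintro ⟨⟨x, hx, rfl⟩, h⟩
    have hadj : (inclL2 Ω).adjoint (f + x none) = ⟨x, hx⟩ :=
      adjoint_inclL2_eq_iff.mpr (by rwa [add_sub_cancel_right])
    rw [resolventOp, ContinuousLinearMap.comp_apply, hadj, inclL2_apply]
  · intro h
    refine ⟨⟨(inclL2 Ω).adjoint (f + u), Submodule.coe_mem _, h⟩, ?_⟩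
    have hlap := adjoint_inclL2_eq_iff.mp (Eq.refl ((inclL2 Ω).adjoint (f + u)))
    rwa [← inclL2_apply, ← ContinuousLinearMap.comp_apply, ← resolventOp, h,
      add_sub_cancel_right] at hlap

lemma exists_mem_H10_inner_resolventOp (f : L2 Ω) : ∃ x ∈ H10 Ω, x none = resolventOp Ω f ∧
    (inner ℂ (resolventOp Ω f) f).re = ‖x none‖ ^ 2 + ∑ i, ‖x (some i)‖ ^ 2 := by
  refine ⟨(inclL2 Ω).adjoint f, Submodule.coe_mem _, rfl, ?_⟩
  rw [resolventOp, ContinuousLinearMap.comp_apply,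
    ← ContinuousLinearMap.adjoint_inner_right, Submodule.coe_inner, inner_jet]
  simp [inner_self_eq_norm_sq_to_K, ← Complex.ofReal_pow]

end Resolvent

section Poincare

lemma enorm_integral_sq_le {α F : Type*} [MeasurableSpace α] {μ : Measure α}
    [IsProbabilityMeasure μ] [NormedAddCommGroup F] [NormedSpace ℝ F] {g : α → F}
    (hg : AEStronglyMeasurable g μ) : ‖∫ a, g a ∂μ‖ₑ ^ 2 ≤ ∫⁻ a, ‖g a‖ₑ ^ 2 ∂μ := by
  have hle : ‖∫ a, g a ∂μ‖ₑ ≤ eLpNorm g 2 μ :=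
    (enorm_integral_le_lintegral_enorm g).trans <| eLpNorm_one_eq_lintegral_enorm.symm.le.trans <|
      eLpNorm_le_eLpNorm_of_exponent_le one_le_two hg
  calc ‖∫ a, g a ∂μ‖ₑ ^ 2 ≤ eLpNorm g 2 μ ^ 2 := by gcongr
    _ = ∫⁻ a, ‖g a‖ₑ ^ 2 ∂μ := by
      simpa using eLpNorm_nnreal_pow_eq_lintegral (f := g) (μ := μ) (p := 2) two_ne_zero

lemma enorm_sq_le_two_mul {F : Type*} [NormedAddCommGroup F] (a b : F) :
    ‖a‖ₑ ^ 2 ≤ 2 * (‖b‖ₑ ^ 2 + ‖a - b‖ₑ ^ 2) := by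
  have h : ‖a‖ ^ 2 ≤ 2 * (‖b‖ ^ 2 + ‖a - b‖ ^ 2) :=
    (pow_le_pow_left₀ (norm_nonneg a) (norm_le_norm_add_norm_sub' a b) 2).trans add_sq_le
  have h' : ‖a‖₊ ^ 2 ≤ 2 * (‖b‖₊ ^ 2 + ‖a - b‖₊ ^ 2) := h
  simpa only [enorm_eq_nnnorm] using mod_cast ENNReal.coe_le_coe.mpr h'

variable {E : Type*} [NormedAddCommGroup E] [MeasurableSpace E] [BorelSpace E] {μ : Measure E}
  {F : Type*} [NormedAddCommGroup F] [NormedSpace ℝ F] [CompleteSpace F] {f : E → F}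

lemma lintegral_enorm_sub_sq_le [NormedSpace ℝ E] [SFinite μ] [μ.IsAddLeftInvariant]
    (hf : ContDiff ℝ 1 f) (h : E) :
    ∫⁻ x, ‖f (x + h) - f x‖ₑ ^ 2 ∂μ ≤ ‖h‖ₑ ^ 2 * ∫⁻ x, ‖fderiv ℝ f x‖ₑ ^ 2 ∂μ := by
  have := hf.continuous_fderiv one_ne_zero
  have hderiv : ∀ x (t : ℝ),
      HasDerivAt (fun t : ℝ => f (x + t • h)) (fderiv ℝ f (x + t • h) h) t := fun x t => by
    refine (hf.differentiable one_ne_zero _).hasFDerivAt.comp_hasDerivAt t ?_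
    simpa using ((hasDerivAt_id t).smul_const h).const_add x
  have hftc : ∀ x, f (x + h) - f x = ∫ t in Set.Ioc (0 : ℝ) 1, fderiv ℝ f (x + t • h) h :=
    fun x => by
      rw [← intervalIntegral.integral_of_le zero_le_one,
        intervalIntegral.integral_eq_sub_of_hasDerivAt (fun t _ => hderiv x t)]
      · simp
      · exact Continuous.intervalIntegrable (by fun_prop) _ _
  have : IsProbabilityMeasure (volume.restrict (Set.Ioc (0 : ℝ) 1)) := ⟨by simp⟩
  calc ∫⁻ x, ‖f (x + h) - f x‖ₑ ^ 2 ∂μ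
      ≤ ∫⁻ x, (∫⁻ t in Set.Ioc (0 : ℝ) 1, ‖fderiv ℝ f (x + t • h) h‖ₑ ^ 2) ∂μ :=
        lintegral_mono fun x => by
          rw [hftc]
          exact enorm_integral_sq_le (Continuous.aestronglyMeasurable (by fun_prop))
    _ = ∫⁻ t in Set.Ioc (0 : ℝ) 1, ∫⁻ x, ‖fderiv ℝ f (x + t • h) h‖ₑ ^ 2 ∂μ :=
        lintegral_lintegral_swap (Continuous.measurable (by fun_prop)).aemeasurable
    _ = ∫⁻ x, ‖fderiv ℝ f x h‖ₑ ^ 2 ∂μ := by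
        simp [lintegral_add_right_eq_self fun x => ‖fderiv ℝ f x h‖ₑ ^ 2]
    _ ≤ ∫⁻ x, ‖h‖ₑ ^ 2 * ‖fderiv ℝ f x‖ₑ ^ 2 ∂μ := lintegral_mono fun x => by
        rw [← mul_pow, mul_comm]
        gcongr
        exact (fderiv ℝ f x).le_opENorm h
    _ = ‖h‖ₑ ^ 2 * ∫⁻ x, ‖fderiv ℝ f x‖ₑ ^ 2 ∂μ :=
        lintegral_const_mul _ (Continuous.measurable (by fun_prop))

lemma setLIntegral_enorm_sq_le [SecondCountableTopology E] {Q : Set E} {v : ℝ≥0∞} (hv : μ Q = v)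
    (hv_zero : v ≠ 0) (hv_top : v ≠ ⊤) (hf : IntegrableOn f Q μ) (hfc : Continuous f) :
    ∫⁻ x in Q, ‖f x‖ₑ ^ 2 ∂μ ≤ 2 * (v⁻¹ * ‖∫ x in Q, f x ∂μ‖ₑ ^ 2 +
      v⁻¹ * ∫⁻ x in Q, ∫⁻ y in Q, ‖f x - f y‖ₑ ^ 2 ∂μ ∂μ) := by
  have hp : IsProbabilityMeasure (v⁻¹ • μ.restrict Q) :=
    ⟨by simp [hv, ENNReal.inv_mul_cancel hv_zero hv_top]⟩
  set m : F := ∫ y, f y ∂(v⁻¹ • μ.restrict Q) with hm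
  have hf' : Integrable f (v⁻¹ • μ.restrict Q) := hf.smul_measure (by simpa using hv_zero)
  have hosc : ∀ x, ‖f x - m‖ₑ ^ 2 ≤ v⁻¹ * ∫⁻ y in Q, ‖f x - f y‖ₑ ^ 2 ∂μ := fun x => by
    have hsub : f x - m = ∫ y, (f x - f y) ∂(v⁻¹ • μ.restrict Q) := by
      rw [integral_sub (integrable_const _) hf', integral_const, probReal_univ, one_smul]
    rw [hsub, ← smul_eq_mul, ← lintegral_smul_measure]
    exact enorm_integral_sq_le (Continuous.aestronglyMeasurable (by fun_prop))
  have hmean : v * ‖m‖ₑ ^ 2 = v⁻¹ * ‖∫ x in Q, f x ∂μ‖ₑ ^ 2 := by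
    rw [hm, integral_smul_measure, enorm_smul, mul_pow, ← mul_assoc, Real.enorm_eq_ofReal (by simp),
      ENNReal.ofReal_toReal (by simpa using hv_zero), sq, ← mul_assoc,
      ENNReal.mul_inv_cancel hv_zero hv_top, one_mul]
  calc ∫⁻ x in Q, ‖f x‖ₑ ^ 2 ∂μ
      ≤ ∫⁻ x in Q, 2 * (‖m‖ₑ ^ 2 + v⁻¹ * ∫⁻ y in Q, ‖f x - f y‖ₑ ^ 2 ∂μ) ∂μ :=
        lintegral_mono fun x => (enorm_sq_le_two_mul (f x) m).trans (by gcongr; exact hosc x)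
    _ = _ := by
        rw [lintegral_const_mul' _ _ (by simp), lintegral_add_left measurable_const,
          lintegral_const, Measure.restrict_apply_univ, hv, mul_comm _ v, hmean,
          lintegral_const_mul' _ _ (by simpa using hv_zero)]

lemma sum_setLIntegral_enorm_sub_sq_le [NormedSpace ℝ E] [SecondCountableTopology E]
    [SFinite μ] [μ.IsAddLeftInvariant] (hf : ContDiff ℝ 1 f) {ι : Type*} {K : Finset ι}
    {Q : ι → Set E} (hQ : ∀ k, MeasurableSet (Q k)) (hdisj : Pairwise (Function.onFun Disjoint Q))
    {r : ℝ} (hr : ∀ k, ∀ x ∈ Q k, ∀ y ∈ Q k, dist x y ≤ r) :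
    ∑ k ∈ K, ∫⁻ x in Q k, ∫⁻ y in Q k, ‖f x - f y‖ₑ ^ 2 ∂μ ∂μ ≤
      μ (Metric.closedBall 0 r) * (ENNReal.ofReal r ^ 2 * ∫⁻ x, ‖fderiv ℝ f x‖ₑ ^ 2 ∂μ) := by
  have hmeas : Measurable fun p : E × E => ‖f (p.1 + p.2) - f p.1‖ₑ ^ 2 :=
    Continuous.measurable (by have := hf.continuous; fun_prop)
  have hsub : ∀ k, ∀ x ∈ Q k, ∫⁻ y in Q k, ‖f x - f y‖ₑ ^ 2 ∂μ ≤
      ∫⁻ h in Metric.closedBall 0 r, ‖f (x + h) - f x‖ₑ ^ 2 ∂μ := fun k x hx => by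
    rw [← lintegral_indicator (hQ k), ← lintegral_add_left_eq_self _ x,
      ← lintegral_indicator Metric.isClosed_closedBall.measurableSet]
    refine lintegral_mono fun h => Set.indicator_apply_le' (fun hxh => ?_) fun _ => zero_le
    have hh : h ∈ Metric.closedBall 0 r := by simpa using hr k _ hxh _ hx
    rw [Set.indicator_of_mem hh, ← edist_eq_enorm_sub, ← edist_eq_enorm_sub, edist_comm]
  calc ∑ k ∈ K, ∫⁻ x in Q k, ∫⁻ y in Q k, ‖f x - f y‖ₑ ^ 2 ∂μ ∂μ
      ≤ ∑ k ∈ K, ∫⁻ x in Q k, ∫⁻ h in Metric.closedBall 0 r, ‖f (x + h) - f x‖ₑ ^ 2 ∂μ ∂μ :=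
        Finset.sum_le_sum fun k _ => setLIntegral_mono' (hQ k) (hsub k)
    _ = ∫⁻ x in ⋃ k ∈ K, Q k, ∫⁻ h in Metric.closedBall 0 r, ‖f (x + h) - f x‖ₑ ^ 2 ∂μ ∂μ :=
        (lintegral_biUnion_finset (hdisj.set_pairwise _) (fun k _ => hQ k) _).symm
    _ ≤ ∫⁻ x, ∫⁻ h in Metric.closedBall 0 r, ‖f (x + h) - f x‖ₑ ^ 2 ∂μ ∂μ :=
        setLIntegral_le_lintegral _ _
    _ = ∫⁻ h in Metric.closedBall 0 r, ∫⁻ x, ‖f (x + h) - f x‖ₑ ^ 2 ∂μ ∂μ :=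
        lintegral_lintegral_swap hmeas.aemeasurable
    _ ≤ ∫⁻ _ in Metric.closedBall 0 r,
          ENNReal.ofReal r ^ 2 * ∫⁻ x, ‖fderiv ℝ f x‖ₑ ^ 2 ∂μ ∂μ := by
        refine setLIntegral_mono' Metric.isClosed_closedBall.measurableSet fun h hh => ?_
        refine (lintegral_enorm_sub_sq_le hf h).trans ?_
        gcongr
        rw [← ofReal_norm]
        exact ENNReal.ofReal_le_ofReal (by simpa using hh)
    _ = _ := by rw [setLIntegral_const, mul_comm]

end Poincare

section Cells

variable {d : ℕ}

/-- The squared norm of the gradient, as an extended nonnegative real. -/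
def gradSq (f : EuclideanSpace ℝ (Fin d) → ℂ) (x : EuclideanSpace ℝ (Fin d)) : ℝ≥0∞ :=
  ∑ i, ‖partialDeriv i f x‖ₑ ^ 2

lemma measurable_gradSq {f : EuclideanSpace ℝ (Fin d) → ℂ} (hf : ContDiff ℝ ∞ f) :
    Measurable (gradSq f) :=
  Finset.measurable_fun_sum _ fun i _ =>
    (contDiff_partialDeriv hf i).continuous.measurable.enorm.pow_const 2

lemma fderiv_apply_eq_sum (f : EuclideanSpace ℝ (Fin d) → ℂ) (x v : EuclideanSpace ℝ (Fin d)) :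
    fderiv ℝ f x v = ∑ i, v i • partialDeriv i f x := by
  conv_lhs => rw [← (EuclideanSpace.basisFun (Fin d) ℝ).sum_repr v]
  simp [partialDeriv]

lemma enorm_fderiv_sq_le_gradSq (f : EuclideanSpace ℝ (Fin d) → ℂ)
    (x : EuclideanSpace ℝ (Fin d)) : ‖fderiv ℝ f x‖ₑ ^ 2 ≤ gradSq f x := by
  set s : ℝ := ∑ i, ‖partialDeriv i f x‖ ^ 2 with hs
  have hs_nonneg : 0 ≤ s := Finset.sum_nonneg fun _ _ => by positivity
  have hbound : ∀ v, ‖fderiv ℝ f x v‖ ≤ √s * ‖v‖ := fun v => by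
    refine abs_le_of_sq_le_sq' ?_ (by positivity) |>.2
    calc ‖fderiv ℝ f x v‖ ^ 2 ≤ (∑ i, ‖v i‖ * ‖partialDeriv i f x‖) ^ 2 := by
          rw [fderiv_apply_eq_sum]
          gcongr
          exact (norm_sum_le _ _).trans_eq (by simp_rw [norm_smul])
      _ ≤ (∑ i, ‖v i‖ ^ 2) * s := Finset.sum_mul_sq_le_sq_mul_sq _ _ _
      _ = (√s * ‖v‖) ^ 2 := by
          rw [← EuclideanSpace.norm_sq_eq, mul_pow, Real.sq_sqrt hs_nonneg, mul_comm]
  calc ‖fderiv ℝ f x‖ₑ ^ 2 = ENNReal.ofReal (‖fderiv ℝ f x‖ ^ 2) := by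
        rw [ENNReal.ofReal_pow (norm_nonneg _), ofReal_norm]
    _ ≤ ENNReal.ofReal (√s ^ 2) := by
        gcongr
        exact ContinuousLinearMap.opNorm_le_bound _ (Real.sqrt_nonneg _) hbound
    _ = gradSq f x := by
        rw [Real.sq_sqrt hs_nonneg, hs, ENNReal.ofReal_sum_of_nonneg fun _ _ => by positivity]
        simp only [ENNReal.ofReal_pow (norm_nonneg _), ofReal_norm, gradSq]

/-- The cell of index `ν` of the partition of `ℝᵈ` into half-open cubes of side `1 / n`. -/
def cell (n : ℕ) [NeZero n] (ν : Fin d → ℤ) : Set (EuclideanSpace ℝ (Fin d)) :=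
  WithLp.ofLp ⁻¹' (BoxIntegral.unitPartition.box n ν : Set (Fin d → ℝ))

variable {n : ℕ} [NeZero n]

lemma measurableSet_cell (ν : Fin d → ℤ) : MeasurableSet (cell n ν) :=
  (BoxIntegral.Box.measurableSet_coe _).preimage (PiLp.volume_preserving_ofLp _).measurable

lemma volume_cell (ν : Fin d → ℤ) : volume (cell n ν) = ((n : ℝ≥0∞) ^ d)⁻¹ := by
  rw [cell, (PiLp.volume_preserving_ofLp _).measure_preimage
    (BoxIntegral.Box.measurableSet_coe _).nullMeasurableSet,
    BoxIntegral.unitPartition.volume_box, Fintype.card_fin, one_div]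

lemma volume_cell_ne_top (ν : Fin d → ℤ) : volume (cell n ν) ≠ ⊤ := by
  simp [volume_cell, NeZero.ne n]

lemma pairwise_disjoint_cell :
    Pairwise (Function.onFun Disjoint (cell n : (Fin d → ℤ) → Set (EuclideanSpace ℝ (Fin d)))) :=
  fun _ _ h => (BoxIntegral.unitPartition.disjoint.mp h).preimage _

lemma dist_le_of_mem_cell {ν : Fin d → ℤ} {x y : EuclideanSpace ℝ (Fin d)} (hx : x ∈ cell n ν)
    (hy : y ∈ cell n ν) : dist x y ≤ √d / n := by
  have hdist : ∀ i, dist (x i) (y i) ^ 2 ≤ (1 / n : ℝ) ^ 2 := fun i => by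
    have hxi := BoxIntegral.unitPartition.mem_box_iff.mp hx i
    have hyi := BoxIntegral.unitPartition.mem_box_iff.mp hy i
    have := add_div (ν i : ℝ) 1 n
    gcongr
    exact abs_sub_le_iff.mpr ⟨by linarith, by linarith⟩
  calc dist x y = √(∑ i, dist (x i) (y i) ^ 2) := EuclideanSpace.dist_eq x y
    _ ≤ √(∑ _i : Fin d, (1 / n : ℝ) ^ 2) := Real.sqrt_le_sqrt (Finset.sum_le_sum fun i _ => hdist i)
    _ = √d / n := by
      rw [Finset.sum_const, Finset.card_univ, Fintype.card_fin, nsmul_eq_mul,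
        Real.sqrt_mul (Nat.cast_nonneg _), Real.sqrt_sq (by positivity), mul_one_div]

lemma exists_finset_subset_biUnion_cell (n : ℕ) [NeZero n] {B : Set (EuclideanSpace ℝ (Fin d))}
    (hB : Bornology.IsBounded B) : ∃ K : Finset (Fin d → ℤ), B ⊆ ⋃ ν ∈ K, cell n ν := by
  obtain ⟨C, hC, hBC⟩ := BoxIntegral.le_hasIntegralVertices_of_isBounded
    ((EuclideanSpace.equiv (Fin d) ℝ).lipschitz.isBounded_image hB)
  refine ⟨BoxIntegral.unitPartition.admissibleIndex n C, fun x hx => ?_⟩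
  have hxC : WithLp.ofLp x ∈ C := hBC (Set.mem_image_of_mem _ hx)
  exact Set.mem_biUnion (BoxIntegral.unitPartition.mem_admissibleIndex_of_mem_box n hC hxC)
    (BoxIntegral.unitPartition.mem_box_iff_index.mpr rfl)

lemma sum_setLIntegral_cell_enorm_sq_le {f : EuclideanSpace ℝ (Fin d) → ℂ} (hf : ContDiff ℝ 1 f)
    (hfi : Integrable f) (K : Finset (Fin d → ℤ)) :
    ∑ ν ∈ K, ∫⁻ x in cell n ν, ‖f x‖ₑ ^ 2 ≤
      2 * (n : ℝ≥0∞) ^ d * ∑ ν ∈ K, ‖∫ x in cell n ν, f x‖ₑ ^ 2 +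
        2 * volume (Metric.closedBall (0 : EuclideanSpace ℝ (Fin d)) √d) *
          ENNReal.ofReal (√d / n) ^ 2 * ∫⁻ x, gradSq f x := by
  have hn : (0 : ℝ) < n := mod_cast NeZero.pos n
  have hball : (n : ℝ≥0∞) ^ d * volume (Metric.closedBall (0 : EuclideanSpace ℝ (Fin d)) (√d / n)) =
      volume (Metric.closedBall (0 : EuclideanSpace ℝ (Fin d)) √d) := by
    have h := Measure.addHaar_closedBall_mul volume (0 : EuclideanSpace ℝ (Fin d)) hn.le
      (s := √d / n) (by positivity)
    rw [mul_div_cancel₀ _ hn.ne', finrank_euclideanSpace_fin, ENNReal.ofReal_pow hn.le,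
      ENNReal.ofReal_natCast] at h
    exact h.symm
  calc ∑ ν ∈ K, ∫⁻ x in cell n ν, ‖f x‖ₑ ^ 2
      ≤ ∑ ν ∈ K, 2 * (((n : ℝ≥0∞) ^ d) * ‖∫ x in cell n ν, f x‖ₑ ^ 2 +
          (n : ℝ≥0∞) ^ d * ∫⁻ x in cell n ν, ∫⁻ y in cell n ν, ‖f x - f y‖ₑ ^ 2) :=
        Finset.sum_le_sum fun ν _ => by
          simpa only [inv_inv] using setLIntegral_enorm_sq_le (volume_cell ν)
            (by simp) (by simp [NeZero.ne n]) hfi.integrableOn hf.continuous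
    _ = 2 * (n : ℝ≥0∞) ^ d * ∑ ν ∈ K, ‖∫ x in cell n ν, f x‖ₑ ^ 2 + 2 * ((n : ℝ≥0∞) ^ d *
          ∑ ν ∈ K, ∫⁻ x in cell n ν, ∫⁻ y in cell n ν, ‖f x - f y‖ₑ ^ 2) := by
        simp only [mul_add, Finset.sum_add_distrib, Finset.mul_sum, mul_assoc]
    _ ≤ 2 * (n : ℝ≥0∞) ^ d * ∑ ν ∈ K, ‖∫ x in cell n ν, f x‖ₑ ^ 2 + 2 * ((n : ℝ≥0∞) ^ d *
          (volume (Metric.closedBall (0 : EuclideanSpace ℝ (Fin d)) (√d / n)) *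
            (ENNReal.ofReal (√d / n) ^ 2 * ∫⁻ x, gradSq f x))) := by
        gcongr
        refine (sum_setLIntegral_enorm_sub_sq_le (μ := volume) hf measurableSet_cell
          pairwise_disjoint_cell fun _ _ hx _ hy => dist_le_of_mem_cell hx hy).trans ?_
        gcongr
        exact enorm_fderiv_sq_le_gradSq f _
    _ = _ := by
        rw [← hball]
        ring

lemma exists_finset_setLIntegral_enorm_sq_le {B : Set (EuclideanSpace ℝ (Fin d))}
    (hB : Bornology.IsBounded B) {ε : ℝ≥0∞} (hε : ε ≠ 0) :
    ∃ (n : ℕ) (_ : NeZero n) (K : Finset (Fin d → ℤ)),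
      ∀ f : EuclideanSpace ℝ (Fin d) → ℂ, ContDiff ℝ 1 f → Integrable f →
        ∫⁻ x in B, ‖f x‖ₑ ^ 2 ≤
          2 * (n : ℝ≥0∞) ^ d * ∑ ν ∈ K, ‖∫ x in cell n ν, f x‖ₑ ^ 2 + ε * ∫⁻ x, gradSq f x := by
  have hlim : Filter.Tendsto (fun n : ℕ => 2 *
      volume (Metric.closedBall (0 : EuclideanSpace ℝ (Fin d)) √d) * ENNReal.ofReal (√d / n) ^ 2)
      Filter.atTop (nhds 0) := by
    have := ENNReal.Tendsto.pow (n := 2)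
      (ENNReal.tendsto_ofReal (tendsto_const_div_atTop_nhds_zero_nat √d))
    simpa using ENNReal.Tendsto.const_mul (a := 2 * volume (Metric.closedBall
      (0 : EuclideanSpace ℝ (Fin d)) √d)) this
      (.inr (ENNReal.mul_ne_top (by simp) Metric.isBounded_closedBall.measure_lt_top.ne))
  obtain ⟨n, hn, hn_pos⟩ := ((hlim.eventually_le_const (pos_of_ne_zero hε)).and
    (Filter.eventually_gt_atTop 0)).exists
  have : NeZero n := ⟨hn_pos.ne'⟩
  obtain ⟨K, hK⟩ := exists_finset_subset_biUnion_cell n hB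
  refine ⟨n, this, K, fun f hf hfi => ?_⟩
  calc ∫⁻ x in B, ‖f x‖ₑ ^ 2 ≤ ∫⁻ x in ⋃ ν ∈ K, cell n ν, ‖f x‖ₑ ^ 2 :=
        lintegral_mono_set hK
    _ = ∑ ν ∈ K, ∫⁻ x in cell n ν, ‖f x‖ₑ ^ 2 := lintegral_biUnion_finset
        (pairwise_disjoint_cell.set_pairwise _) (fun ν _ => measurableSet_cell ν) _
    _ ≤ _ := (sum_setLIntegral_cell_enorm_sq_le hf hfi K).trans (by gcongr)

end Cells

section Wirtinger

variable {F : Type*} [NormedAddCommGroup F] [InnerProductSpace ℝ F] {w w' : ℝ → F}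

-- The boundary terms of `‖w' + v w‖² ≥ 0` vanish, and the equation turns the rest into `κ ‖w‖²`.
lemma mul_integral_norm_sq_le_of_riccati {a b κ : ℝ} (hab : a ≤ b) {v : ℝ → ℝ}
    (hv : ∀ t ∈ Set.Icc a b, HasDerivAt v (κ + v t ^ 2) t) (hw : ∀ t, HasDerivAt w (w' t) t)
    (hw' : Continuous w') (ha : w a = 0) (hb : w b = 0) :
    κ * ∫ t in a..b, ‖w t‖ ^ 2 ≤ ∫ t in a..b, ‖w' t‖ ^ 2 := by
  have hw_cont : Continuous w := continuous_iff_continuousAt.mpr fun t => (hw t).continuousAt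
  have hv_cont : ContinuousOn v (Set.Icc a b) := fun t ht =>
    (hv t ht).continuousAt.continuousWithinAt
  set D : ℝ → ℝ := fun t => (κ + v t ^ 2) * ‖w t‖ ^ 2 + v t * (2 * inner ℝ (w t) (w' t))
  have hderiv : ∀ t ∈ Set.Icc a b, HasDerivAt (fun t => v t * ‖w t‖ ^ 2) (D t) t :=
    fun t ht => (hv t ht).mul (hw t).norm_sq
  have hD_int : IntervalIntegrable D volume a b :=
    ContinuousOn.intervalIntegrable (by rw [Set.uIcc_of_le hab]; fun_prop)
  have hD_zero : ∫ t in a..b, D t = 0 := by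
    rw [intervalIntegral.integral_eq_sub_of_hasDerivAt
      (f := fun t => v t * ‖w t‖ ^ 2) (by rwa [Set.uIcc_of_le hab]) hD_int]
    simp [ha, hb]
  have hsquare : ∀ t, κ * ‖w t‖ ^ 2 ≤ ‖w' t‖ ^ 2 + D t := fun t => by
    have h : ‖w' t + v t • w t‖ ^ 2 = ‖w' t‖ ^ 2 + 2 * (v t * inner ℝ (w t) (w' t)) +
        v t ^ 2 * ‖w t‖ ^ 2 := by
      rw [norm_add_sq_real, inner_smul_right, real_inner_comm, norm_smul, mul_pow,
        Real.norm_eq_abs, sq_abs]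
    linarith [sq_nonneg ‖w' t + v t • w t‖]
  have hw'_int : IntervalIntegrable (fun t => ‖w' t‖ ^ 2) volume a b :=
    Continuous.intervalIntegrable (by fun_prop) _ _
  rw [← intervalIntegral.integral_const_mul]
  calc ∫ t in a..b, κ * ‖w t‖ ^ 2 ≤ ∫ t in a..b, (‖w' t‖ ^ 2 + D t) :=
        intervalIntegral.integral_mono_on hab
          (Continuous.intervalIntegrable (by fun_prop) _ _) (hw'_int.add hD_int)
          fun t _ => hsquare t
    _ = ∫ t in a..b, ‖w' t‖ ^ 2 := by
      rw [intervalIntegral.integral_add hw'_int hD_int, hD_zero, add_zero]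

lemma hasDerivAt_mul_tan {α t c : ℝ} (h : Real.cos (α * (t - c)) ≠ 0) :
    HasDerivAt (fun t => α * Real.tan (α * (t - c)))
      (α ^ 2 + (α * Real.tan (α * (t - c))) ^ 2) t := by
  have harg : HasDerivAt (fun t : ℝ => α * (t - c)) α t := by
    simpa using ((hasDerivAt_id t).sub_const c).const_mul α
  refine (((Real.hasDerivAt_tan h).comp t harg).const_mul α).congr_deriv ?_
  rw [one_div, ← Real.inv_one_add_tan_sq h, inv_inv]
  ring

lemma integral_norm_sq_le_integral_norm_deriv_sq (hw : ∀ t, HasDerivAt w (w' t) t)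
    (hw' : Continuous w') (h_zero : w 0 = 0) (h_pi : w Real.pi = 0) :
    ∫ t in 0..Real.pi, ‖w t‖ ^ 2 ≤ ∫ t in 0..Real.pi, ‖w' t‖ ^ 2 := by
  have hlim : Filter.Tendsto (fun α : ℝ => α ^ 2 * ∫ t in 0..Real.pi, ‖w t‖ ^ 2)
      (nhdsWithin 1 (Set.Iio 1)) (nhds (1 ^ 2 * ∫ t in 0..Real.pi, ‖w t‖ ^ 2)) :=
    Filter.Tendsto.mono_left (Continuous.tendsto (by fun_prop) 1) nhdsWithin_le_nhds
  rw [one_pow, one_mul] at hlim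
  refine le_of_tendsto hlim ?_
  filter_upwards [Ioo_mem_nhdsLT (zero_lt_one (α := ℝ))] with α ⟨hα_pos, hα_lt⟩
  refine mul_integral_norm_sq_le_of_riccati Real.pi_nonneg (fun t ht => hasDerivAt_mul_tan
    (c := Real.pi / 2) (Real.cos_pos_of_mem_Ioo ⟨?_, ?_⟩).ne') hw hw' h_zero h_pi
  · nlinarith [ht.1, ht.2, Real.pi_pos]
  · nlinarith [ht.1, ht.2, Real.pi_pos]

lemma lintegral_Ioc_enorm_sq {E : Type*} [NormedAddCommGroup E] {f : ℝ → E} (hf : Continuous f)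
    {a b : ℝ} (hab : a ≤ b) :
    ∫⁻ t in Set.Ioc a b, ‖f t‖ₑ ^ 2 = ENNReal.ofReal (∫ t in a..b, ‖f t‖ ^ 2) := by
  rw [intervalIntegral.integral_of_le hab, ofReal_integral_eq_lintegral_ofReal
    (Continuous.integrableOn_Ioc (by fun_prop)) (.of_forall fun t => by positivity)]
  simp_rw [ENNReal.ofReal_pow (norm_nonneg _), ofReal_norm]

lemma lintegral_enorm_sq_le_lintegral_enorm_deriv_sq (hw : ∀ t, HasDerivAt w (w' t) t)
    (hw' : Continuous w') (h_zero : w 0 = 0) (h_pi : w Real.pi = 0) :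
    ∫⁻ t in Set.Ioc 0 Real.pi, ‖w t‖ₑ ^ 2 ≤ ∫⁻ t in Set.Ioc 0 Real.pi, ‖w' t‖ₑ ^ 2 := by
  have hw_cont : Continuous w := continuous_iff_continuousAt.mpr fun t => (hw t).continuousAt
  rw [lintegral_Ioc_enorm_sq hw_cont Real.pi_nonneg, lintegral_Ioc_enorm_sq hw' Real.pi_nonneg]
  exact ENNReal.ofReal_le_ofReal (integral_norm_sq_le_integral_norm_deriv_sq hw hw' h_zero h_pi)

end Wirtinger

section Frame

/-- The Euclidean plane. -/
abbrev Plane : Type := EuclideanSpace ℝ (Fin 2)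

variable (b : OrthonormalBasis (Fin 2) ℝ Plane)

/-- The parametrization `(s, t) ↦ s b₀ + t b₁` of the plane by the coordinates in an orthonormal
basis `b`. -/
def frame : ℝ × ℝ ≃ᵐ Plane :=
  (MeasurableEquiv.finTwoArrow.symm.trans (MeasurableEquiv.toLp 2 (Fin 2 → ℝ))).trans
    b.repr.symm.toMeasurableEquiv

lemma measurePreserving_frame : MeasurePreserving (frame b) :=
  ((PiLp.volume_preserving_toLp (Fin 2)).comp
    ((volume_preserving_finTwoArrow ℝ).symm _)).trans b.measurePreserving_repr_symm

lemma repr_frame (p : ℝ × ℝ) : b.repr (frame b p) = !₂[p.1, p.2] :=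
  b.repr.apply_symm_apply _

lemma frame_apply (p : ℝ × ℝ) : frame b p = p.1 • b 0 + p.2 • b 1 := by
  rw [← b.sum_repr (frame b p), Fin.sum_univ_two, repr_frame]
  rfl

lemma hasDerivAt_frame_snd {f : Plane → ℂ} (hf : ContDiff ℝ ∞ f) (s t : ℝ) :
    HasDerivAt (fun t => f (frame b (s, t))) (fderiv ℝ f (frame b (s, t)) (b 1)) t := by
  have hframe : HasDerivAt (fun t => frame b (s, t)) (b 1) t := by
    simp_rw [frame_apply]
    simpa using ((hasDerivAt_id t).smul_const (b 1)).const_add (s • b 0)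
  exact (hf.differentiable (by simp) _).hasFDerivAt.comp_hasDerivAt t hframe

/-- The points of the plane whose first coordinate in the basis `b` lies in `A` and whose second
coordinate lies in `B`. -/
def rectangle (A B : Set ℝ) : Set Plane := {x | b.repr x 0 ∈ A ∧ b.repr x 1 ∈ B}

lemma measurableSet_rectangle {A B : Set ℝ} (hA : MeasurableSet A) (hB : MeasurableSet B) :
    MeasurableSet (rectangle b A B) := by
  have hcoord : ∀ i, Measurable fun x => b.repr x i := fun i =>
    Continuous.measurable (by fun_prop)
  exact (hcoord 0 hA).inter (hcoord 1 hB)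

lemma setLIntegral_rectangle {f : Plane → ℝ≥0∞} (hf : Measurable f) (A B : Set ℝ) :
    ∫⁻ x in rectangle b A B, f x = ∫⁻ s in A, ∫⁻ t in B, f (frame b (s, t)) := by
  have hpreimage : frame b ⁻¹' rectangle b A B = A ×ˢ B := by
    ext p
    simp [rectangle, repr_frame]
  rw [← (measurePreserving_frame b).setLIntegral_comp_preimage_emb (frame b).measurableEmbedding,
    hpreimage, Measure.volume_eq_prod]
  exact setLIntegral_prod _ (hf.comp (frame b).measurable).aemeasurable

lemma setLIntegral_rectangle_enorm_sq_le {A : Set ℝ} (hA : MeasurableSet A) {f : Plane → ℂ}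
    (hf : ContDiff ℝ ∞ f) (h_zero : ∀ s ∈ A, f (frame b (s, 0)) = 0)
    (h_pi : ∀ s ∈ A, f (frame b (s, Real.pi)) = 0) :
    ∫⁻ x in rectangle b A (Set.Ioc 0 Real.pi), ‖f x‖ₑ ^ 2 ≤
      ∫⁻ x in rectangle b A (Set.Ioc 0 Real.pi), gradSq f x := by
  have hderiv_cont : ∀ s, Continuous fun t => fderiv ℝ f (frame b (s, t)) (b 1) := fun s => by
    have := hf.continuous_fderiv (by simp)
    simp_rw [frame_apply]
    fun_prop
  rw [setLIntegral_rectangle b (hf.continuous.measurable.enorm.pow_const 2),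
    setLIntegral_rectangle b (measurable_gradSq hf)]
  refine setLIntegral_mono' hA fun s hs => ?_
  calc ∫⁻ t in Set.Ioc 0 Real.pi, ‖f (frame b (s, t))‖ₑ ^ 2
      ≤ ∫⁻ t in Set.Ioc 0 Real.pi, ‖fderiv ℝ f (frame b (s, t)) (b 1)‖ₑ ^ 2 :=
        lintegral_enorm_sq_le_lintegral_enorm_deriv_sq (hasDerivAt_frame_snd b hf s)
          (hderiv_cont s) (h_zero s hs) (h_pi s hs)
    _ ≤ ∫⁻ t in Set.Ioc 0 Real.pi, gradSq f (frame b (s, t)) := by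
        refine lintegral_mono fun t => le_trans ?_ (enorm_fderiv_sq_le_gradSq f _)
        gcongr
        refine (ContinuousLinearMap.le_opENorm _ _).trans_eq ?_
        rw [← ofReal_norm (b 1), b.norm_eq_one, ENNReal.ofReal_one, mul_one]

lemma norm_le_abs_repr_add_abs_repr (x : Plane) : ‖x‖ ≤ |b.repr x 0| + |b.repr x 1| := by
  conv_lhs => rw [← b.sum_repr x, Fin.sum_univ_two]
  refine (norm_add_le _ _).trans_eq ?_
  simp only [norm_smul, b.norm_eq_one, mul_one, Real.norm_eq_abs]

end Frame

section Geometry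

variable {θ σ : ℝ}

lemma orthonormal_guideBasis (θ : ℝ) (hσ : σ * σ = 1) :
    Orthonormal ℝ (![!₂[Real.cos θ, σ * Real.sin θ], !₂[-Real.sin θ, σ * Real.cos θ]] :
      Fin 2 → Plane) := by
  have hθ := Real.sin_sq_add_cos_sq θ
  have hinner : ∀ v w : Plane, inner ℝ v w = w 0 * v 0 + w 1 * v 1 := fun v w => by
    rw [PiLp.inner_apply, Fin.sum_univ_two]
    rfl
  rw [orthonormal_iff_ite]
  intro i j
  rw [hinner]
  fin_cases i <;> fin_cases j <;>
    simp only [Fin.zero_eta, Fin.mk_one, Matrix.cons_val_zero, Matrix.cons_val_one,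
      Matrix.cons_val_fin_one, zero_ne_one, one_ne_zero, ↓reduceIte]
  · linear_combination hθ + Real.sin θ ^ 2 * hσ
  · linear_combination Real.sin θ * Real.cos θ * hσ
  · linear_combination Real.sin θ * Real.cos θ * hσ
  · linear_combination hθ + Real.cos θ ^ 2 * hσ

/-- The tangential and normal unit vectors of the upper (`σ = 1`) and lower (`σ = -1`) arms of
the broken guide. -/
def guideBasis (θ : ℝ) (hσ : σ * σ = 1) : OrthonormalBasis (Fin 2) ℝ Plane :=
  (basisOfOrthonormalOfCardEqFinrank (orthonormal_guideBasis θ hσ) (by simp)).toOrthonormalBasis (by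
    rw [coe_basisOfOrthonormalOfCardEqFinrank]
    exact orthonormal_guideBasis θ hσ)

variable (hσ : σ * σ = 1) (x : Plane)

include hσ in
lemma abs_eq_mul_of_mul_self_eq_one {y : ℝ} (hy : 0 ≤ σ * y) : |y| = σ * y := by
  have hσ_abs : |σ| = 1 := by rw [← Real.sqrt_mul_self_eq_abs, hσ, Real.sqrt_one]
  rw [← abs_of_nonneg hy, abs_mul, hσ_abs, one_mul]

lemma repr_guideBasis_zero :
    (guideBasis θ hσ).repr x 0 = x 0 * Real.cos θ + σ * x 1 * Real.sin θ := by
  simp only [OrthonormalBasis.repr_apply_apply, guideBasis, Module.Basis.coe_toOrthonormalBasis,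
    coe_basisOfOrthonormalOfCardEqFinrank, Matrix.cons_val_zero, Matrix.cons_val_one,
    Matrix.cons_val_fin_one, PiLp.inner_apply, RCLike.inner_apply, Real.ringHom_apply,
    Fin.sum_univ_two]
  ring

lemma repr_guideBasis_one :
    (guideBasis θ hσ).repr x 1 = -(x 0 * Real.sin θ) + σ * x 1 * Real.cos θ := by
  simp only [OrthonormalBasis.repr_apply_apply, guideBasis, Module.Basis.coe_toOrthonormalBasis,
    coe_basisOfOrthonormalOfCardEqFinrank, Matrix.cons_val_zero, Matrix.cons_val_one,
    Matrix.cons_val_fin_one, PiLp.inner_apply, RCLike.inner_apply, Real.ringHom_apply,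
    Fin.sum_univ_two]
  ring

lemma mul_eq_repr_guideBasis :
    σ * x 1 = (guideBasis θ hσ).repr x 0 * Real.sin θ +
      (guideBasis θ hσ).repr x 1 * Real.cos θ := by
  rw [repr_guideBasis_zero, repr_guideBasis_one]
  linear_combination -(σ * x 1) * Real.sin_sq_add_cos_sq θ

lemma sin_pos_of_mem (hθ : θ ∈ Set.Ioo 0 (Real.pi / 2)) : 0 < Real.sin θ :=
  Real.sin_pos_of_pos_of_lt_pi hθ.1 (by linarith [hθ.2, Real.pi_pos])

lemma cos_pos_of_mem (hθ : θ ∈ Set.Ioo 0 (Real.pi / 2)) : 0 < Real.cos θ :=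
  Real.cos_pos_of_mem_Ioo ⟨by linarith [hθ.1, Real.pi_pos], hθ.2⟩

variable (hθ : θ ∈ Set.Ioo 0 (Real.pi / 2)) {x}

include hθ

lemma mem_brokenGuide_iff :
    x ∈ brokenGuide θ ↔ |x 1| * Real.cos θ - x 0 * Real.sin θ ∈ Set.Ioo 0 Real.pi := by
  have hsin := sin_pos_of_mem hθ
  have hcos := cos_pos_of_mem hθ
  change (x 0 * Real.tan θ < |x 1| ∧ |x 1| < (x 0 + Real.pi / Real.sin θ) * Real.tan θ) ↔ _
  rw [Real.tan_eq_sin_div_cos, ← mul_div_assoc, div_lt_iff₀ hcos, ← mul_div_assoc,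
    lt_div_iff₀ hcos, add_mul, div_mul_cancel₀ _ hsin.ne', Set.mem_Ioo, sub_pos, sub_lt_iff_lt_add']

lemma mem_brokenGuide_iff_repr (hx : 0 ≤ σ * x 1) :
    x ∈ brokenGuide θ ↔ (guideBasis θ hσ).repr x 1 ∈ Set.Ioo 0 Real.pi := by
  rw [mem_brokenGuide_iff hθ, repr_guideBasis_one, abs_eq_mul_of_mul_self_eq_one hσ hx,
    neg_add_eq_sub]

/-- The straight part of an arm of the broken guide. -/
abbrev halfStrip (θ : ℝ) (hσ : σ * σ = 1) : Set Plane :=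
  rectangle (guideBasis θ hσ) (Set.Ioi 0) (Set.Ioc 0 Real.pi)

lemma mul_pos_of_mem_halfStrip (hx : x ∈ halfStrip θ hσ) : 0 < σ * x 1 := by
  rw [mul_eq_repr_guideBasis (θ := θ) hσ x]
  exact add_pos (mul_pos hx.1 (sin_pos_of_mem hθ)) (mul_pos hx.2.1 (cos_pos_of_mem hθ))

lemma notMem_brokenGuide_frame {s t : ℝ} (hs : 0 < s) (ht : t = 0 ∨ t = Real.pi) :
    frame (guideBasis θ hσ) (s, t) ∉ brokenGuide θ := by
  have hsin := sin_pos_of_mem hθ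
  have hcos := cos_pos_of_mem hθ
  have ht_nonneg : 0 ≤ t := by rcases ht with rfl | rfl <;> positivity
  rw [mem_brokenGuide_iff_repr hσ hθ, repr_frame]
  · rcases ht with rfl | rfl <;> simp
  · rw [mul_eq_repr_guideBasis (θ := θ) hσ, repr_frame]
    change 0 ≤ s * Real.sin θ + t * Real.cos θ
    positivity

lemma setLIntegral_halfStrip_enorm_sq_le (φ : 𝓓(brokenGuide θ, ℂ)) :
    ∫⁻ x in halfStrip θ hσ, ‖φ x‖ₑ ^ 2 ≤ ∫⁻ x in halfStrip θ hσ, gradSq φ x := by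
  have hφ : ∀ {x}, x ∉ brokenGuide θ → φ x = 0 := fun hx =>
    image_eq_zero_of_notMem_tsupport fun h => hx (φ.tsupport_subset h)
  exact setLIntegral_rectangle_enorm_sq_le _ measurableSet_Ioi φ.contDiff
    (fun s hs => hφ (notMem_brokenGuide_frame hσ hθ hs (.inl rfl)))
    (fun s hs => hφ (notMem_brokenGuide_frame hσ hθ hs (.inr rfl)))

lemma mem_halfStrip_or_mem_closedBall (hx : 0 ≤ σ * x 1) (hx_mem : x ∈ brokenGuide θ) :
    x ∈ halfStrip θ hσ ∨ x ∈ Metric.closedBall 0 (Real.pi / Real.sin θ + Real.pi) := by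
  have hsin := sin_pos_of_mem hθ
  obtain ⟨ht_pos, ht_lt⟩ := (mem_brokenGuide_iff_repr hσ hθ hx).mp hx_mem
  refine or_iff_not_imp_left.mpr fun hx_strip => ?_
  have hs_nonpos : (guideBasis θ hσ).repr x 0 ≤ 0 :=
    not_lt.mp fun hs => hx_strip ⟨hs, ht_pos, ht_lt.le⟩
  have hs_ge : -(guideBasis θ hσ).repr x 0 ≤ Real.pi / Real.sin θ := by
    rw [mul_eq_repr_guideBasis (θ := θ) hσ x] at hx
    rw [le_div_iff₀ hsin]
    nlinarith [mul_le_of_le_one_right ht_pos.le (Real.cos_le_one θ)]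
  rw [mem_closedBall_zero_iff]
  refine (norm_le_abs_repr_add_abs_repr (guideBasis θ hσ) x).trans ?_
  rw [abs_of_nonpos hs_nonpos, abs_of_pos ht_pos]
  exact add_le_add hs_ge ht_lt.le

lemma lintegral_enorm_sq_le_gradSq_add_closedBall (φ : 𝓓(brokenGuide θ, ℂ)) :
    ∫⁻ x, ‖φ x‖ₑ ^ 2 ≤ (∫⁻ x, gradSq φ x) +
      ∫⁻ x in Metric.closedBall 0 (Real.pi / Real.sin θ + Real.pi), ‖φ x‖ₑ ^ 2 := by
  have hneg : (-1 : ℝ) * -1 = 1 := by norm_num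
  set U := halfStrip θ (one_mul (1 : ℝ))
  set D := halfStrip θ hneg
  set B : Set Plane := Metric.closedBall 0 (Real.pi / Real.sin θ + Real.pi)
  have hD : MeasurableSet D := measurableSet_rectangle _ measurableSet_Ioi measurableSet_Ioc
  have hdisj : Disjoint U D := Set.disjoint_left.mpr fun x hxU hxD => by
    linarith [mul_pos_of_mem_halfStrip _ hθ hxU, mul_pos_of_mem_halfStrip _ hθ hxD]
  have hcover : ∀ x ∈ brokenGuide θ, x ∈ U ∪ D ∪ B := fun x hx => by
    rcases le_total 0 (x 1) with h | h
    · exact (mem_halfStrip_or_mem_closedBall (one_mul 1) hθ (by simpa) hx).imp_left .inl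
    · exact (mem_halfStrip_or_mem_closedBall hneg hθ (by simpa) hx).imp_left .inr
  have hsupp : Function.support (fun x => ‖φ x‖ₑ ^ 2) ⊆ U ∪ D ∪ B := fun x hx =>
    hcover x (φ.tsupport_subset (subset_tsupport _ fun h => hx (by simp [h])))
  calc ∫⁻ x, ‖φ x‖ₑ ^ 2 = ∫⁻ x in U ∪ D ∪ B, ‖φ x‖ₑ ^ 2 :=
        (setLIntegral_eq_of_support_subset hsupp).symm
    _ ≤ (∫⁻ x in U ∪ D, ‖φ x‖ₑ ^ 2) + ∫⁻ x in B, ‖φ x‖ₑ ^ 2 := lintegral_union_le _ _ _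
    _ ≤ (∫⁻ x in U ∪ D, gradSq φ x) + ∫⁻ x in B, ‖φ x‖ₑ ^ 2 := by
        rw [lintegral_union hD hdisj, lintegral_union hD hdisj]
        gcongr ?_ + ?_ + _
        · exact setLIntegral_halfStrip_enorm_sq_le _ hθ φ
        · exact setLIntegral_halfStrip_enorm_sq_le _ hθ φ
    _ ≤ _ := by
        gcongr
        exact Measure.restrict_le_self

end Geometry

section Coercivity

variable {d : ℕ} {Ω : Opens (EuclideanSpace ℝ (Fin d))}

lemma enorm_contL2_sq {ψ : EuclideanSpace ℝ (Fin d) → ℂ} (hc : Continuous ψ)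
    (hs : HasCompactSupport ψ) :
    ‖contL2 Ω hc hs‖ₑ ^ 2 = ∫⁻ x in (Ω : Set (EuclideanSpace ℝ (Fin d))), ‖ψ x‖ₑ ^ 2 := by
  rw [Lp.enorm_def, eLpNorm_congr_ae (coeFn_contL2 hc hs)]
  simpa using eLpNorm_nnreal_pow_eq_lintegral (p := 2) (f := ψ) two_ne_zero

lemma support_testFunction_subset (φ : 𝓓(Ω, ℂ)) : Function.support φ ⊆ Ω :=
  (subset_tsupport _).trans φ.tsupport_subset

lemma enorm_contL2_testFunction_sq (φ : 𝓓(Ω, ℂ)) :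
    ‖contL2 Ω φ.continuous φ.hasCompactSupport‖ₑ ^ 2 = ∫⁻ x, ‖φ x‖ₑ ^ 2 := by
  rw [enorm_contL2_sq]
  refine setLIntegral_eq_of_support_subset fun x hx => support_testFunction_subset φ fun h => hx ?_
  simp [h]

lemma sum_enorm_testJet_some_sq (φ : 𝓓(Ω, ℂ)) :
    ∑ i, ‖testJet φ (some i)‖ₑ ^ 2 = ∫⁻ x, gradSq φ x := by
  simp_rw [gradSq]
  rw [lintegral_finsetSum _ fun i _ =>
    (continuous_partialDeriv φ i).measurable.enorm.pow_const 2]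
  exact Finset.sum_congr rfl fun i _ => enorm_contL2_testFunction_sq (partialTest i φ)

/-- The class in `L²(Ω)` of the indicator function of a cell. -/
def cellIndicator (Ω : Opens (EuclideanSpace ℝ (Fin d))) (n : ℕ) [NeZero n] (ν : Fin d → ℤ) :
    L2 Ω :=
  indicatorConstLp 2 (measurableSet_cell (n := n) ν)
    ((Measure.restrict_apply_le _ _).trans_lt (volume_cell_ne_top ν).lt_top).ne 1

lemma inner_cellIndicator_testJet_none (n : ℕ) [NeZero n] (ν : Fin d → ℤ) (φ : 𝓓(Ω, ℂ)) :
    inner ℂ (cellIndicator Ω n ν) (testJet φ none) = ∫ x in cell n ν, φ x := by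
  rw [cellIndicator, L2.inner_indicatorConstLp_one, testJet_none,
    integral_congr_ae (ae_restrict_of_ae (coeFn_contL2 φ.continuous φ.hasCompactSupport)),
    Measure.restrict_restrict (measurableSet_cell ν), Set.inter_comm,
    ← Measure.restrict_restrict Ω.isOpen.measurableSet]
  exact setIntegral_eq_integral_of_forall_compl_eq_zero fun x hx =>
    Function.notMem_support.mp fun h => hx (support_testFunction_subset φ h)

variable {B : Set (EuclideanSpace ℝ (Fin d))} {κ : ℝ} (hB : Bornology.IsBounded B)
  (h : ∀ φ : 𝓓(Ω, ℂ), ENNReal.ofReal κ * ∫⁻ x, ‖φ x‖ₑ ^ 2 ≤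
    (∫⁻ x, gradSq φ x) + ∫⁻ x in B, ‖φ x‖ₑ ^ 2)

include hB h

lemma exists_finset_enorm_sq_le_of_mem_H10 {ε : ℝ≥0∞} (hε : ε ≠ 0) (hε_top : ε ≠ ⊤) :
    ∃ (n : ℕ) (_ : NeZero n) (K : Finset (Fin d → ℤ)), ∀ x ∈ H10 Ω,
      ENNReal.ofReal κ * ‖x none‖ₑ ^ 2 ≤ (1 + ε) * ∑ i, ‖x (some i)‖ₑ ^ 2 +
        2 * (n : ℝ≥0∞) ^ d * ∑ ν ∈ K, ‖inner ℂ (cellIndicator Ω n ν) (x none)‖ₑ ^ 2 := by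
  obtain ⟨n, hn, K, hK⟩ := exists_finset_setLIntegral_enorm_sq_le hB hε
  refine ⟨n, hn, K, fun x hx => H10_induction (p := fun x => ENNReal.ofReal κ * ‖x none‖ₑ ^ 2 ≤
    (1 + ε) * ∑ i, ‖x (some i)‖ₑ ^ 2 +
      2 * (n : ℝ≥0∞) ^ d * ∑ ν ∈ K, ‖inner ℂ (cellIndicator Ω n ν) (x none)‖ₑ ^ 2)
    ?_ (fun φ => ?_) hx⟩
  · have hconst : 2 * (n : ℝ≥0∞) ^ d ≠ ⊤ := by finiteness
    have hconst' : 1 + ε ≠ ⊤ := by finiteness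
    have : ∀ o, Continuous fun x : Jet Ω => x o := continuous_jet_apply
    exact isClosed_le
      (ENNReal.continuous_const_mul ENNReal.ofReal_ne_top |>.comp (by fun_prop))
      ((ENNReal.continuous_const_mul hconst' |>.comp (by fun_prop)).add
        (ENNReal.continuous_const_mul hconst |>.comp (by fun_prop)))
  · simp_rw [inner_cellIndicator_testJet_none]
    rw [sum_enorm_testJet_some_sq, testJet_none, enorm_contL2_testFunction_sq]
    calc ENNReal.ofReal κ * ∫⁻ x, ‖φ x‖ₑ ^ 2
        ≤ (∫⁻ x, gradSq φ x) + ∫⁻ x in B, ‖φ x‖ₑ ^ 2 := h φ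
      _ ≤ (∫⁻ x, gradSq φ x) + (2 * (n : ℝ≥0∞) ^ d * ∑ ν ∈ K, ‖∫ x in cell n ν, φ x‖ₑ ^ 2 +
            ε * ∫⁻ x, gradSq φ x) := by
          gcongr
          exact hK φ (φ.contDiff.of_le (by simp))
            (φ.continuous.integrable_of_hasCompactSupport φ.hasCompactSupport)
      _ = _ := by ring

lemma exists_coFG_mul_norm_sq_le {c : ℝ} (hc : 0 < c) (hcκ : c < κ) :
    ∃ S : Submodule ℂ (L2 Ω), IsClosed (S : Set (L2 Ω)) ∧ S.CoFG ∧
      ∀ x ∈ H10 Ω, x none ∈ S → c * ‖x none‖ ^ 2 ≤ ∑ i, ‖x (some i)‖ ^ 2 := by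
  have hκ : 0 < κ := hc.trans hcκ
  have hε : 0 < κ / c - 1 := sub_pos.mpr ((one_lt_div hc).mpr hcκ)
  obtain ⟨n, _, K, hK⟩ := exists_finset_enorm_sq_le_of_mem_H10 hB h
    (ENNReal.ofReal_pos.mpr hε).ne' ENNReal.ofReal_ne_top
  let T : L2 Ω →L[ℂ] (K → ℂ) := ContinuousLinearMap.pi fun ν => innerSL ℂ (cellIndicator Ω n ν)
  refine ⟨T.ker, T.isClosed_ker, Submodule.CoFG.ker _, fun x hx hxS => ?_⟩
  have horth : ∀ ν ∈ K, inner ℂ (cellIndicator Ω n ν) (x none) = 0 := fun ν hν =>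
    congrFun (LinearMap.mem_ker.mp hxS) ⟨ν, hν⟩
  have hle : κ * ‖x none‖ ^ 2 ≤ κ / c * ∑ i, ‖x (some i)‖ ^ 2 := by
    have hsum : ∑ i, ‖x (some i)‖ₑ ^ 2 = ENNReal.ofReal (∑ i, ‖x (some i)‖ ^ 2) := by
      rw [ENNReal.ofReal_sum_of_nonneg fun i _ => by positivity]
      simp_rw [ENNReal.ofReal_pow (norm_nonneg _), ofReal_norm]
    have hK := hK x hx
    have hinner_sum : ∑ ν ∈ K, ‖inner ℂ (cellIndicator Ω n ν) (x none)‖ₑ ^ 2 = 0 :=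
      Finset.sum_eq_zero fun ν hν => by simp [horth ν hν]
    rw [hinner_sum, mul_zero, add_zero, hsum,
      ← ofReal_norm, ← ENNReal.ofReal_pow (norm_nonneg _), ← ENNReal.ofReal_one,
      ← ENNReal.ofReal_add zero_le_one hε.le, add_sub_cancel,
      ← ENNReal.ofReal_mul hκ.le, ← ENNReal.ofReal_mul (by positivity)] at hK
    exact (ENNReal.ofReal_le_ofReal_iff (by positivity)).mp hK
  rw [div_mul_eq_mul_div, mul_div_assoc] at hle
  exact (le_div_iff₀' hc).mp (le_of_mul_le_mul_left hle hκ)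

theorem isFredholm_subScalar_of_forall_lintegral_le (hκ : 0 < κ) {z : ℂ}
    (hz : z ∉ Complex.ofReal '' Set.Ici κ) :
    IsFredholm (subScalar (dirichletLaplacian Ω) z) := by
  obtain ⟨c, ⟨hc_pos, hcκ⟩, hzc⟩ : ∃ c ∈ Set.Ioo 0 κ, z ∉ Complex.ofReal '' Set.Ici c := by
    by_cases hz_real : ∃ r : ℝ, (r : ℂ) = z
    · obtain ⟨r, rfl⟩ := hz_real
      have hr : max r 0 < κ := max_lt (not_le.mp fun hr => hz ⟨r, hr, rfl⟩) hκ
      obtain ⟨c, hrc, hcκ⟩ := exists_between hr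
      refine ⟨c, ⟨(le_max_right _ _).trans_lt hrc, hcκ⟩, ?_⟩
      rintro ⟨s, hs, hsr⟩
      exact ((le_max_left r 0).trans_lt hrc).not_ge (Complex.ofReal_injective hsr ▸ hs)
    · exact ⟨κ / 2, ⟨half_pos hκ, half_lt_self hκ⟩, fun ⟨s, _, hs⟩ => hz_real ⟨s, hs⟩⟩
  obtain ⟨S, hS_closed, _, hS⟩ := exists_coFG_mul_norm_sq_le hB h hc_pos hcκ
  refine isInvAddOne_resolventOp.isFredholm_subScalar isSelfAdjoint_resolventOp hS_closed
    (fun f hf => ?_) hzc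
  obtain ⟨x, hx, hxf, hinner⟩ := exists_mem_H10_inner_resolventOp f
  rw [← hxf] at hf ⊢
  rw [← hxf] at hinner
  linarith [hS x hx hf]

end Coercivity

theorem isFredholm_brokenGuide {θ : ℝ} (hθ : θ ∈ Set.Ioo 0 (Real.pi / 2)) {z : ℂ}
    (hz : z ∉ Complex.ofReal '' Set.Ici 1) :
    IsFredholm (subScalar (dirichletLaplacian (brokenGuide θ)) z) :=
  isFredholm_subScalar_of_forall_lintegral_le Metric.isBounded_closedBall
    (fun φ => by
      rw [ENNReal.ofReal_one, one_mul]
      exact lintegral_enorm_sq_le_gradSq_add_closedBall hθ φ)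
    one_pos hz

section WeylSequence

variable {d : ℕ} {Ω : Opens (EuclideanSpace ℝ (Fin d))}

lemma tendsto_zero_of_enorm_sq {E : Type*} [SeminormedAddGroup E] {v : ℕ → E}
    (h : Filter.Tendsto (fun n => ‖v n‖ₑ ^ 2) Filter.atTop (nhds 0)) :
    Filter.Tendsto v Filter.atTop (nhds 0) := by
  rw [tendsto_zero_iff_norm_tendsto_zero]
  have hreal := (ENNReal.tendsto_toReal ENNReal.zero_ne_top).comp h
  simpa [Function.comp_def, Real.sqrt_sq] using hreal.sqrt

lemma lintegral_enorm_sq_ne_top {X E : Type*} [TopologicalSpace X] [MeasurableSpace X]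
    [OpensMeasurableSpace X] [NormedAddCommGroup E] {μ : Measure X} [IsFiniteMeasureOnCompacts μ]
    {f : X → E} (hf : Continuous f) (hf_supp : HasCompactSupport f) :
    ∫⁻ x, ‖f x‖ₑ ^ 2 ∂μ ≠ ⊤ := by
  simpa using (lintegral_rpow_enorm_lt_top_of_eLpNorm_lt_top two_ne_zero
    ENNReal.ofNat_ne_top (hf.memLp_of_hasCompactSupport (p := 2) (μ := μ) hf_supp).2).ne

lemma contL2_sub {f g : EuclideanSpace ℝ (Fin d) → ℂ} (hf : Continuous f)
    (hf_supp : HasCompactSupport f) (hg : Continuous g) (hg_supp : HasCompactSupport g) :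
    contL2 Ω (hf.sub hg) (hf_supp.sub hg_supp) = contL2 Ω hf hf_supp - contL2 Ω hg hg_supp :=
  rfl

lemma tendsto_contL2 {F : ℕ → EuclideanSpace ℝ (Fin d) → ℂ} {f : EuclideanSpace ℝ (Fin d) → ℂ}
    (hF : ∀ n, Continuous (F n)) (hF_supp : ∀ n, HasCompactSupport (F n))
    (hf : Continuous f) (hf_supp : HasCompactSupport f)
    {G : EuclideanSpace ℝ (Fin d) → ℝ} (hG : Continuous G) (hG_supp : HasCompactSupport G)
    (hle : ∀ n x, ‖F n x - f x‖ ≤ G x) (heq : ∀ x ∈ Ω, ∀ᶠ n in Filter.atTop, F n x = f x) :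
    Filter.Tendsto (fun n => contL2 Ω (hF n) (hF_supp n)) Filter.atTop
      (nhds (contL2 Ω hf hf_supp)) := by
  rw [← tendsto_sub_nhds_zero_iff]
  refine tendsto_zero_of_enorm_sq ?_
  simp_rw [← contL2_sub, enorm_contL2_sq]
  rw [← lintegral_zero]
  refine tendsto_lintegral_of_dominated_convergence (fun x => ‖G x‖ₑ ^ 2)
    (fun n => ((hF n).sub hf).measurable.enorm.pow_const 2)
    (fun n => Filter.Eventually.of_forall fun x => ?_) ?_ ?_
  · exact pow_le_pow_left' (enorm_le_iff_norm_le.mpr ((hle n x).trans (le_abs_self _))) 2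
  · exact lintegral_enorm_sq_ne_top hG hG_supp
  · filter_upwards [ae_restrict_mem Ω.isOpen.measurableSet] with x hx
    refine tendsto_const_nhds.congr' ?_
    filter_upwards [heq x hx] with n hn
    simp [hn]

lemma memH10_of_tendsto {φ : ℕ → 𝓓(Ω, ℂ)} {x : Jet Ω}
    (h : ∀ o, Filter.Tendsto (fun n => testJet (φ n) o) Filter.atTop (nhds (x o))) :
    MemH10 (x none) := by
  refine memH10_iff.mpr ⟨x, mem_closure_of_tendsto (f := fun n => testJet (φ n))
    (b := Filter.atTop) ?_ (Filter.Eventually.of_forall fun n => ⟨φ n, rfl⟩), rfl⟩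
  exact ((PiLp.continuous_toLp 2 _).tendsto _).comp (tendsto_pi_nhds.mpr h)

end WeylSequence

section Truncation

/-- A smooth approximation of the identity of `[0, ∞)` which vanishes on `(-∞, 1 / (n + 1)]`. -/
def truncation (n : ℕ) (y : ℝ) : ℝ := y * Real.smoothTransition ((n + 1) * y - 1)

lemma contDiff_truncation (n : ℕ) : ContDiff ℝ ∞ (truncation n) :=
  contDiff_id.mul (Real.smoothTransition.contDiff.comp
    ((contDiff_const.mul contDiff_id).sub contDiff_const))

lemma truncation_eq_zero {n : ℕ} {y : ℝ} (h : (n + 1) * y ≤ 1) : truncation n y = 0 := by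
  rw [truncation, Real.smoothTransition.zero_of_nonpos (sub_nonpos.mpr h), mul_zero]

lemma truncation_eq_self {n : ℕ} {y : ℝ} (h : 2 ≤ (n + 1) * y) : truncation n y = y := by
  rw [truncation, Real.smoothTransition.one_of_one_le (by linarith), mul_one]

lemma abs_truncation_sub_le (n : ℕ) (y : ℝ) : |truncation n y - y| ≤ |y| := by
  have hnonneg := Real.smoothTransition.nonneg ((n + 1) * y - 1)
  have hle := Real.smoothTransition.le_one ((n + 1) * y - 1)
  rw [truncation, ← mul_sub_one, abs_mul]
  exact mul_le_of_le_one_right (abs_nonneg y) (abs_le.mpr ⟨by linarith, by linarith⟩)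

lemma deriv_truncation (n : ℕ) (y : ℝ) :
    deriv (truncation n) y = deriv (truncation 0) ((n + 1) * y) := by
  have hscale : truncation n = fun y => (n + 1 : ℝ)⁻¹ * truncation 0 ((n + 1) * y) := by
    ext y
    simp only [truncation]
    field_simp
    simp
  rw [hscale, deriv_const_mul_field, deriv_comp_mul_left, smul_eq_mul,
    inv_mul_cancel_left₀ (by positivity)]

lemma exists_abs_deriv_truncation_sub_one_le :
    ∃ C, ∀ (n : ℕ) (y : ℝ), |deriv (truncation n) y - 1| ≤ C := by
  have hcont := (contDiff_truncation 0).continuous_deriv (by simp)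
  obtain ⟨C, hC⟩ := (isCompact_Icc (a := (1 : ℝ)) (b := 2)).exists_bound_of_continuousOn
    (hcont.sub (continuous_const (y := (1 : ℝ)))).continuousOn
  refine ⟨max C 1, fun n y => ?_⟩
  rw [deriv_truncation]
  set w := (n + 1) * y
  rcases lt_or_ge w 1 with hw | hw
  · have hzero : truncation 0 =ᶠ[nhds w] fun _ => 0 := by
      filter_upwards [Iio_mem_nhds hw] with v hv
      exact truncation_eq_zero (by simpa using le_of_lt hv)
    rw [hzero.deriv_eq]
    simp
  rcases lt_or_ge 2 w with hw' | hw'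
  · have hid : truncation 0 =ᶠ[nhds w] id := by
      filter_upwards [Ioi_mem_nhds hw'] with v hv
      exact truncation_eq_self (by simpa using le_of_lt hv)
    rw [hid.deriv_eq]
    simp
  · exact (hC w ⟨hw, hw'⟩).trans (le_max_left _ _)

lemma eventually_truncation_eventuallyEq {y : ℝ} (hy : 0 < y) :
    ∀ᶠ n in Filter.atTop, truncation n =ᶠ[nhds y] id := by
  obtain ⟨N, hN⟩ := exists_nat_gt (2 / (y / 2))
  rw [div_lt_iff₀ (half_pos hy)] at hN
  filter_upwards [Filter.eventually_ge_atTop N] with n hn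
  filter_upwards [Ioi_mem_nhds (half_lt_self hy)] with v hv
  refine truncation_eq_self (hN.le.trans ?_)
  have hNn : (N : ℝ) ≤ n + 1 := by exact_mod_cast hn.trans n.le_succ
  exact mul_le_mul hNn (le_of_lt hv) (half_pos hy).le (by positivity)

end Truncation

section WeylCriterion

variable {d : ℕ} {Ω : Opens (EuclideanSpace ℝ (Fin d))} {f : EuclideanSpace ℝ (Fin d) → ℂ}

section Product

variable {p : EuclideanSpace ℝ (Fin d) → ℝ}

lemma contDiff_mul_comp (hf : ContDiff ℝ ∞ f) (hp : ContDiff ℝ ∞ p) {g : ℝ → ℝ}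
    (hg : ContDiff ℝ ∞ g) : ContDiff ℝ ∞ fun x => f x * (g (p x) : ℂ) :=
  hf.mul (Complex.ofRealCLM.contDiff.comp (hg.comp hp))

lemma partialDeriv_mul_comp (hf : ContDiff ℝ ∞ f) (hp : ContDiff ℝ ∞ p) {g : ℝ → ℝ}
    (hg : ContDiff ℝ ∞ g) (i : Fin d) (x : EuclideanSpace ℝ (Fin d)) :
    partialDeriv i (fun x => f x * (g (p x) : ℂ)) x = partialDeriv i f x * (g (p x) : ℂ) +
      f x * (deriv g (p x) * fderiv ℝ p x (EuclideanSpace.single i 1) : ℝ) := by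
  have hderiv_comp := ((hg.differentiable (by simp) (p x)).hasDerivAt.comp_hasFDerivAt x
    (hp.differentiable (by simp) x).hasFDerivAt)
  have hderiv := (hf.differentiable (by simp) x).hasFDerivAt.mul
    (Complex.ofRealCLM.hasFDerivAt.comp x hderiv_comp)
  change fderiv ℝ (f * (Complex.ofRealCLM ∘ g ∘ p)) x _ = _
  rw [hderiv.fderiv]
  exact (add_comm _ _).trans (congrArg (· + _) (mul_comm _ _))

lemma tsupport_mul_truncation_subset (hp : Continuous p) (n : ℕ) :
    tsupport (fun x => f x * (truncation n (p x) : ℂ)) ⊆ {x ∈ tsupport f | 0 < p x} := by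
  have hclosed : IsClosed {x ∈ tsupport f | (1 : ℝ) ≤ (n + 1) * p x} :=
    (isClosed_tsupport f).inter (isClosed_le continuous_const (continuous_const.mul hp))
  refine (closure_minimal (fun x hx => ?_) hclosed).trans fun x hx =>
    ⟨hx.1, pos_of_mul_pos_right (one_pos.trans_le hx.2) (by positivity)⟩
  rw [Function.mem_support, mul_ne_zero_iff, Complex.ofReal_ne_zero] at hx
  exact ⟨subset_tsupport f hx.1, le_of_not_ge fun h => hx.2 (truncation_eq_zero h)⟩

lemma eventually_mul_truncation_eventuallyEq (hp : Continuous p) {x : EuclideanSpace ℝ (Fin d)}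
    (hx : x ∈ tsupport f → 0 < p x) :
    ∀ᶠ n in Filter.atTop,
      (fun x => f x * (truncation n (p x) : ℂ)) =ᶠ[nhds x] fun x => f x * (p x : ℂ) := by
  by_cases hxf : x ∈ tsupport f
  · filter_upwards [eventually_truncation_eventuallyEq (hx hxf)] with n hn
    filter_upwards [hp.continuousAt.eventually hn] with y hy
    rw [hy, id]
  · refine Filter.Eventually.of_forall fun n => ?_
    filter_upwards [notMem_tsupport_iff_eventuallyEq.mp hxf] with y hy
    simp [hy]

lemma exists_norm_partialDeriv_mul_truncation_sub_le (hf : ContDiff ℝ ∞ f)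
    (hp : ContDiff ℝ ∞ p) :
    ∃ C : ℝ, ∀ (n : ℕ) (i : Fin d) (x : EuclideanSpace ℝ (Fin d)),
      ‖partialDeriv i (fun x => f x * (truncation n (p x) : ℂ)) x -
        partialDeriv i (fun x => f x * (p x : ℂ)) x‖ ≤
      ‖partialDeriv i f x‖ * |p x| +
        ‖f x‖ * (C * |fderiv ℝ p x (EuclideanSpace.single i 1)|) := by
  obtain ⟨C, hC⟩ := exists_abs_deriv_truncation_sub_one_le
  refine ⟨C, fun n i x => ?_⟩
  have hid := partialDeriv_mul_comp hf hp contDiff_id i x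
  simp only [id, deriv_id', one_mul] at hid
  calc _ = ‖partialDeriv i f x * ((truncation n (p x) - p x : ℝ) : ℂ) + f x *
        ((deriv (truncation n) (p x) - 1) * fderiv ℝ p x (EuclideanSpace.single i 1) : ℝ)‖ := by
        rw [partialDeriv_mul_comp hf hp (contDiff_truncation n), hid]
        push_cast
        ring_nf
    _ ≤ _ := by
        refine (norm_add_le _ _).trans ?_
        simp only [norm_mul, Complex.norm_real, Real.norm_eq_abs]
        exact add_le_add
          (mul_le_mul_of_nonneg_left (abs_truncation_sub_le n (p x)) (norm_nonneg _))
          (mul_le_mul_of_nonneg_left (mul_le_mul_of_nonneg_right (hC n (p x)) (abs_nonneg _))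
            (norm_nonneg _))

/-- The truncations of `p` at positive levels give test functions converging to `f * p` in `H¹`. -/
lemma memH10_contL2_mul (hf : ContDiff ℝ ∞ f) (hf_supp : HasCompactSupport f)
    (hp : ContDiff ℝ ∞ p) (hΩ : ∀ x ∈ tsupport f, x ∈ Ω ↔ 0 < p x)
    (hfp : Continuous fun x => f x * (p x : ℂ)) :
    MemH10 (contL2 Ω hfp hf_supp.mul_right) := by
  have hF := contDiff_mul_comp hf hp contDiff_id
  let φ : ℕ → 𝓓(Ω, ℂ) := fun n =>
    ⟨fun x => f x * (truncation n (p x) : ℂ), contDiff_mul_comp hf hp (contDiff_truncation n),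
      hf_supp.mul_right, fun x hx =>
        have h := tsupport_mul_truncation_subset hp.continuous n hx
        (hΩ x h.1).mpr h.2⟩
  have hφ : ∀ x ∈ Ω, ∀ᶠ n in Filter.atTop, φ n =ᶠ[nhds x] fun x => f x * (p x : ℂ) :=
    fun x hx => eventually_mul_truncation_eventuallyEq hp.continuous fun h => (hΩ x h).mp hx
  obtain ⟨C, hC⟩ := exists_norm_partialDeriv_mul_truncation_sub_le hf hp
  refine memH10_of_tendsto (φ := φ) (x := WithLp.toLp 2 fun o => o.elim
    (contL2 Ω hfp hf_supp.mul_right) fun i =>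
      contL2 Ω (contDiff_partialDeriv hF i).continuous (hf_supp.mul_right.fderiv_apply ℝ _)) ?_
  rintro (_ | i)
  · refine tendsto_contL2 (fun n => (φ n).continuous) (fun n => (φ n).hasCompactSupport)
      hfp hf_supp.mul_right (hf.continuous.norm.mul hp.continuous.abs) hf_supp.norm.mul_right
      (fun n x => ?_) fun x hx => (hφ x hx).mono fun n hn => hn.eq_of_nhds
    change ‖f x * (truncation n (p x) : ℂ) - f x * (p x : ℂ)‖ ≤ ‖f x‖ * |p x|
    rw [← mul_sub, ← Complex.ofReal_sub, norm_mul, Complex.norm_real]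
    exact mul_le_mul_of_nonneg_left (abs_truncation_sub_le n (p x)) (norm_nonneg _)
  · have hp' : Continuous fun x => fderiv ℝ p x (EuclideanSpace.single i 1) :=
      (hp.continuous_fderiv (by simp)).clm_apply continuous_const
    have hf' := (contDiff_partialDeriv hf i).continuous
    exact tendsto_contL2 (fun n => continuous_partialDeriv (φ n) i)
      (fun n => hasCompactSupport_partialDeriv (φ n) i) (contDiff_partialDeriv hF i).continuous
      (hf_supp.mul_right.fderiv_apply ℝ _)
      ((hf'.norm.mul hp.continuous.abs).add
        (hf.continuous.norm.mul (continuous_const.mul hp'.abs)))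
      ((hf_supp.fderiv_apply ℝ _).norm.mul_right.add hf_supp.norm.mul_right)
      (fun n x => hC n i x) fun x hx => (hφ x hx).mono fun n hn =>
        DFunLike.congr_fun hn.fderiv_eq (EuclideanSpace.single i 1)

end Product

lemma contDiff_laplacian (hf : ContDiff ℝ ∞ f) : ContDiff ℝ ∞ (Laplacian.laplacian f) := by
  rw [funext (laplacian_eq_sum_partialDeriv hf)]
  exact ContDiff.sum fun i _ => contDiff_partialDeriv (contDiff_partialDeriv hf i) i

lemma support_laplacian_subset (hf : ContDiff ℝ ∞ f) :
    Function.support (Laplacian.laplacian f) ⊆ tsupport f := fun x hx => by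
  rw [Function.mem_support, laplacian_eq_sum_partialDeriv hf] at hx
  obtain ⟨i, -, hi⟩ := Finset.exists_ne_zero_of_sum_ne_zero hx
  exact tsupport_partialDeriv_subset f i
    (tsupport_partialDeriv_subset (partialDeriv i f) i (subset_tsupport _ hi))

lemma isWeakLaplacian_contL2 (hf : ContDiff ℝ ∞ f) (hf_supp : HasCompactSupport f) :
    IsWeakLaplacian (contL2 Ω hf.continuous hf_supp)
      (contL2 Ω (contDiff_laplacian hf).continuous (hf_supp.mono' (support_laplacian_subset hf))) :=
  fun φ => by
  refine Eq.trans ?_ ((integral_mul_laplacian_testFunction hf φ).trans ?_) <;>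
    refine integral_congr_ae ?_
  · filter_upwards [coeFn_contL2 (Ω := Ω) hf.continuous hf_supp] with x hx
    rw [hx]
  · filter_upwards [coeFn_contL2 (Ω := Ω) (contDiff_laplacian hf).continuous
      (hf_supp.mono' (support_laplacian_subset hf))] with x hx
    rw [hx]

theorem not_isFredholm_subScalar_of_disjoint_support {f : ℕ → EuclideanSpace ℝ (Fin d) → ℂ}
    (hf : ∀ n, ContDiff ℝ ∞ (f n)) (hf_supp : ∀ n, HasCompactSupport (f n))
    (hmem : ∀ n, MemH10 (contL2 Ω (hf n).continuous (hf_supp n)))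
    (hdisj : Pairwise fun n m => Disjoint (Function.support (f n)) (Function.support (f m)))
    {c M : ℝ≥0∞} (hc : c ≠ 0) (hM : M ≠ ⊤)
    (hcf : ∀ n, c ≤ ∫⁻ x in (Ω : Set (EuclideanSpace ℝ (Fin d))), ‖f n x‖ₑ ^ 2)
    (hfM : ∀ n, ∫⁻ x in (Ω : Set (EuclideanSpace ℝ (Fin d))), ‖f n x‖ₑ ^ 2 ≤ M) {z : ℂ}
    (hlim : Filter.Tendsto (fun n => ∫⁻ x in (Ω : Set (EuclideanSpace ℝ (Fin d))),
      ‖Laplacian.laplacian (f n) x + z * f n x‖ₑ ^ 2) Filter.atTop (nhds 0)) :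
    ¬ IsFredholm (subScalar (dirichletLaplacian Ω) z) := by
  let g : ℕ → L2 Ω := fun n => -contL2 Ω (contDiff_laplacian (hf n)).continuous
    ((hf_supp n).mono' (support_laplacian_subset (hf n)))
  have hnorm : ∀ v : L2 Ω, ‖v‖ = √(‖v‖ₑ ^ 2).toReal := fun v => by simp
  have hc_top : c ≠ ⊤ := ((hcf 0).trans (hfM 0)).trans_lt hM.lt_top |>.ne
  refine isInvAddOne_resolventOp.not_isFredholm_subScalar_of_separated
    (g := g) (M := √M.toReal) (c := √c.toReal)
    (fun n => mem_graph_dirichletLaplacian.mpr ⟨hmem n, ?_⟩) (fun n => ?_)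
    (Real.sqrt_pos.mpr (ENNReal.toReal_pos hc hc_top)) (fun n m hnm => ?_) ?_
  · rw [neg_neg]
    exact isWeakLaplacian_contL2 (hf n) (hf_supp n)
  · rw [hnorm, enorm_contL2_sq]
    exact Real.sqrt_le_sqrt (ENNReal.toReal_mono hM (hfM n))
  · change √c.toReal ≤ ‖contL2 Ω _ _ - contL2 Ω _ _‖
    rw [hnorm, ← contL2_sub]
    refine Real.sqrt_le_sqrt (ENNReal.toReal_mono (by finiteness) ((hcf n).trans ?_))
    rw [enorm_contL2_sq]
    refine lintegral_mono fun x => ?_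
    by_cases hx : f n x = 0
    · simp [hx]
    · simp [Function.notMem_support.mp ((hdisj hnm).notMem_of_mem_left hx)]
  · refine tendsto_zero_of_enorm_sq ((Filter.tendsto_congr fun n => ?_).mpr hlim)
    have hresidual : g n - z • contL2 Ω (hf n).continuous (hf_supp n) = -contL2 Ω
        ((contDiff_laplacian (hf n)).continuous.add (continuous_const.mul (hf n).continuous))
        (((hf_supp n).mono' (support_laplacian_subset (hf n))).add
          (hf_supp n).mul_left) :=
      (neg_add' _ _).symm
    rw [hresidual, enorm_neg, enorm_contL2_sq]
    rfl

end WeylCriterion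

section Tensor

variable (b : OrthonormalBasis (Fin 2) ℝ Plane) {a p : ℝ → ℂ}

/-- The function `x ↦ a s * p t`, where `(s, t)` are the coordinates of `x` in the basis `b`. -/
def tensor (a p : ℝ → ℂ) (x : Plane) : ℂ := a (b.repr x 0) * p (b.repr x 1)

lemma contDiff_repr (i : Fin 2) : ContDiff ℝ ∞ fun x => b.repr x i := by
  simp_rw [OrthonormalBasis.repr_apply_apply]
  exact contDiff_const.inner ℝ contDiff_id

lemma contDiff_tensor (ha : ContDiff ℝ ∞ a) (hp : ContDiff ℝ ∞ p) :
    ContDiff ℝ ∞ (tensor b a p) :=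
  (ha.comp (contDiff_repr b 0)).mul (hp.comp (contDiff_repr b 1))

lemma isCompact_rectangle {A B : Set ℝ} (hA : IsCompact A) (hB : IsCompact B) :
    IsCompact (rectangle b A B) := by
  have hframe : Continuous (frame b) := by
    simp_rw [funext (frame_apply b)]
    fun_prop
  have himage : frame b '' A ×ˢ B = rectangle b A B := by
    ext x
    refine ⟨?_, fun hx => ⟨(b.repr x 0, b.repr x 1), hx, ?_⟩⟩
    · rintro ⟨q, hq, rfl⟩
      simpa [rectangle, repr_frame] using hq
    · rw [frame_apply, ← Fin.sum_univ_two (fun i => b.repr x i • b i), b.sum_repr]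
  exact himage ▸ (hA.prod hB).image hframe

lemma tsupport_tensor_subset :
    tsupport (tensor b a p) ⊆ rectangle b (tsupport a) (tsupport p) := by
  refine closure_minimal (fun x hx => ?_)
    (((isClosed_tsupport a).preimage (contDiff_repr b 0).continuous).inter
      ((isClosed_tsupport p).preimage (contDiff_repr b 1).continuous))
  rw [Function.mem_support, tensor, mul_ne_zero_iff] at hx
  exact ⟨subset_tsupport a hx.1, subset_tsupport p hx.2⟩

lemma hasCompactSupport_tensor (ha : HasCompactSupport a) (hp : HasCompactSupport p) :
    HasCompactSupport (tensor b a p) :=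
  (isCompact_rectangle b ha.isCompact hp.isCompact).of_isClosed_subset (isClosed_tsupport _)
    (tsupport_tensor_subset b)

lemma fderiv_tensor (ha : Differentiable ℝ a) (hp : Differentiable ℝ p) (x w : Plane) :
    fderiv ℝ (tensor b a p) x w =
      b.repr w 0 * tensor b (deriv a) p x + b.repr w 1 * tensor b a (deriv p) x := by
  have hrepr : ∀ i : Fin 2, HasFDerivAt (fun x => b.repr x i) (innerSL ℝ (b i)) x := fun i => by
    simp_rw [OrthonormalBasis.repr_apply_apply]
    exact (innerSL ℝ (b i)).hasFDerivAt
  have hderiv : HasFDerivAt (tensor b a p) _ x :=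
    ((ha _).hasDerivAt.hasFDerivAt.comp x (hrepr 0)).mul
      ((hp _).hasDerivAt.hasFDerivAt.comp x (hrepr 1))
  rw [hderiv.fderiv]
  simp only [OrthonormalBasis.repr_apply_apply, Function.comp_apply, add_apply, smul_apply,
    ContinuousLinearMap.comp_apply, coe_innerSL_apply, ContinuousLinearMap.toSpanSingleton_apply,
    Complex.real_smul, smul_eq_mul, tensor]
  ring

lemma laplacian_tensor (ha : ContDiff ℝ ∞ a) (hp : ContDiff ℝ ∞ p) (x : Plane) :
    Laplacian.laplacian (tensor b a p) x =
      tensor b (deriv (deriv a)) p x + tensor b a (deriv (deriv p)) x := by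
  have ha' : Differentiable ℝ (deriv a) := (contDiff_infty_iff_deriv.mp ha).2.differentiable
    (by simp)
  have hp' : Differentiable ℝ (deriv p) := (contDiff_infty_iff_deriv.mp hp).2.differentiable
    (by simp)
  have hlaplacian := laplacian_eq_sum_fderiv b (contDiff_tensor b ha hp) x
  replace ha := ha.differentiable (by simp)
  replace hp := hp.differentiable (by simp)
  have hderiv_zero : (fun y => fderiv ℝ (tensor b a p) y (b 0)) = tensor b (deriv a) p :=
    funext fun y => by simp [fderiv_tensor b ha hp]
  have hderiv_one : (fun y => fderiv ℝ (tensor b a p) y (b 1)) = tensor b a (deriv p) :=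
    funext fun y => by simp [fderiv_tensor b ha hp]
  rw [hlaplacian, Fin.sum_univ_two, hderiv_zero, hderiv_one, fderiv_tensor b ha' hp,
    fderiv_tensor b ha hp']
  simp

lemma setLIntegral_rectangle_enorm_tensor_sq (ha : Continuous a) (hp : Continuous p)
    (A B : Set ℝ) :
    ∫⁻ x in rectangle b A B, ‖tensor b a p x‖ₑ ^ 2 =
      (∫⁻ s in A, ‖a s‖ₑ ^ 2) * ∫⁻ t in B, ‖p t‖ₑ ^ 2 := by
  have hmeas : Measurable fun x => ‖tensor b a p x‖ₑ ^ 2 :=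
    ((ha.comp (contDiff_repr b 0).continuous).mul
      (hp.comp (contDiff_repr b 1).continuous)).measurable.enorm.pow_const 2
  have htensor : ∀ s t, ‖tensor b a p (frame b (s, t))‖ₑ ^ 2 = ‖a s‖ₑ ^ 2 * ‖p t‖ₑ ^ 2 :=
    fun s t => by simp [tensor, repr_frame, mul_pow]
  simp_rw [setLIntegral_rectangle b hmeas, htensor]
  rw [← lintegral_mul_const _ (ha.measurable.enorm.pow_const 2)]
  exact lintegral_congr fun s => lintegral_const_mul _ (hp.measurable.enorm.pow_const 2)

end Tensor

section UpperArm

variable {θ : ℝ} {a p : ℝ → ℂ}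

/-- The tangential and normal unit vectors of the upper arm of the broken guide. -/
abbrev upperBasis (θ : ℝ) : OrthonormalBasis (Fin 2) ℝ Plane := guideBasis θ (one_mul 1)

/-- A neighbourhood of the straight part of the upper arm which stays in the upper half plane. -/
def farArm (θ : ℝ) : Set Plane :=
  rectangle (upperBasis θ) (Set.Ioi (Real.cos θ / Real.sin θ)) (Set.Ioo (-1) (Real.pi + 1))

lemma mem_brokenGuide_iff_of_mem_farArm (hθ : θ ∈ Set.Ioo 0 (Real.pi / 2)) {x : Plane}
    (hx : x ∈ farArm θ) :
    x ∈ brokenGuide θ ↔ (upperBasis θ).repr x 1 ∈ Set.Ioo 0 Real.pi := by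
  refine mem_brokenGuide_iff_repr (one_mul 1) hθ ?_
  obtain ⟨hs, ht, -⟩ := hx
  rw [Set.mem_Ioi, div_lt_iff₀ (sin_pos_of_mem hθ)] at hs
  rw [mul_eq_repr_guideBasis (θ := θ) (one_mul 1)]
  nlinarith [cos_pos_of_mem hθ]

lemma mem_farArm_of_tensor_ne_zero (ha : Function.support a ⊆ Set.Ioi (Real.cos θ / Real.sin θ))
    (hp : Function.support p ⊆ Set.Ioo (-1) (Real.pi + 1)) {x : Plane}
    (hx : tensor (upperBasis θ) a p x ≠ 0) : x ∈ farArm θ :=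
  ⟨ha (left_ne_zero_of_mul hx), hp (right_ne_zero_of_mul hx)⟩

lemma setLIntegral_brokenGuide_enorm_tensor_sq (hθ : θ ∈ Set.Ioo 0 (Real.pi / 2))
    (ha : Continuous a) (ha_supp : Function.support a ⊆ Set.Ioi (Real.cos θ / Real.sin θ))
    (hp : Continuous p) (hp_supp : Function.support p ⊆ Set.Ioo (-1) (Real.pi + 1)) :
    ∫⁻ x in (brokenGuide θ : Set Plane), ‖tensor (upperBasis θ) a p x‖ₑ ^ 2 =
      (∫⁻ s, ‖a s‖ₑ ^ 2) * ∫⁻ t in Set.Ioo 0 Real.pi, ‖p t‖ₑ ^ 2 := by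
  rw [← setLIntegral_univ fun s => ‖a s‖ₑ ^ 2,
    ← setLIntegral_rectangle_enorm_tensor_sq (upperBasis θ) ha hp,
    ← lintegral_indicator (brokenGuide θ).isOpen.measurableSet,
    ← lintegral_indicator (measurableSet_rectangle _ MeasurableSet.univ measurableSet_Ioo)]
  refine lintegral_congr fun x => ?_
  by_cases hx : tensor (upperBasis θ) a p x = 0
  · simp [Set.indicator, hx]
  · simp only [Set.indicator, SetLike.mem_coe, rectangle, Set.mem_ofPred_eq, Set.mem_univ, true_and,
      mem_brokenGuide_iff_of_mem_farArm hθ (mem_farArm_of_tensor_ne_zero ha_supp hp_supp hx)]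

end UpperArm

section TransverseMode

/-- A smooth cutoff equal to `1` on the cross section `[0, π]` of the arms. -/
def crossBump : ContDiffBump (Real.pi / 2 : ℝ) where
  rIn := Real.pi / 2
  rOut := Real.pi / 2 + 1 / 2
  rIn_pos := Real.pi_div_two_pos
  rIn_lt_rOut := by norm_num

/-- The first Dirichlet eigenfunction of the cross section, cut off outside of it. -/
def crossMode (t : ℝ) : ℂ := (crossBump t : ℂ) * (Real.sin t : ℂ)

lemma contDiff_crossBump : ContDiff ℝ ∞ fun t => (crossBump t : ℂ) :=
  Complex.ofRealCLM.contDiff.comp crossBump.contDiff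

lemma contDiff_crossMode : ContDiff ℝ ∞ crossMode :=
  contDiff_crossBump.mul (Complex.ofRealCLM.contDiff.comp Real.contDiff_sin)

lemma hasCompactSupport_crossBump : HasCompactSupport fun t => (crossBump t : ℂ) :=
  crossBump.hasCompactSupport.comp_left Complex.ofReal_zero

lemma hasCompactSupport_crossMode : HasCompactSupport crossMode :=
  hasCompactSupport_crossBump.mul_right

lemma tsupport_crossBump_subset :
    tsupport (fun t => (crossBump t : ℂ)) ⊆ Set.Ioo (-1) (Real.pi + 1) := by
  refine (closure_mono (Function.support_comp_subset Complex.ofReal_zero crossBump)).trans ?_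
  change tsupport crossBump ⊆ _
  rw [crossBump.tsupport_eq, Real.closedBall_eq_Icc]
  refine Set.Icc_subset_Ioo ?_ ?_ <;> simp only [crossBump] <;> linarith

lemma tsupport_crossMode_subset : tsupport crossMode ⊆ Set.Ioo (-1) (Real.pi + 1) :=
  (tsupport_mul_subset_left).trans tsupport_crossBump_subset

lemma crossMode_eqOn : Set.EqOn crossMode (fun t => (Real.sin t : ℂ)) (Set.Ioo 0 Real.pi) :=
  fun t ht => by
  have hone : crossBump t = 1 := crossBump.one_of_mem_closedBall <| by
    rw [Real.closedBall_eq_Icc]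
    constructor <;> simp only [crossBump] <;> linarith [ht.1, ht.2]
  simp [crossMode, hone]

lemma deriv_deriv_crossMode {t : ℝ} (ht : t ∈ Set.Ioo 0 Real.pi) :
    deriv (deriv crossMode) t = -crossMode t := by
  have hsin : crossMode =ᶠ[nhds t] fun t => (Real.sin t : ℂ) :=
    crossMode_eqOn.eventuallyEq_of_mem (isOpen_Ioo.mem_nhds ht)
  have hcos : ∀ t, deriv (fun t : ℝ => (Real.sin t : ℂ)) t = Real.cos t :=
    fun t => (Real.hasDerivAt_sin t).ofReal_comp.deriv
  rw [hsin.deriv.deriv_eq, funext hcos, (Real.hasDerivAt_cos t).ofReal_comp.deriv,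
    crossMode_eqOn ht, Complex.ofReal_neg]

lemma setLIntegral_crossMode_ne_zero :
    ∫⁻ t in Set.Ioo 0 Real.pi, ‖crossMode t‖ₑ ^ 2 ≠ 0 := by
  have hsupp : Set.Ioo 0 Real.pi ⊆ Function.support fun t => ‖crossMode t‖ₑ ^ 2 := fun t ht => by
    simp [crossMode_eqOn ht, -Complex.ofReal_sin, (Real.sin_pos_of_mem_Ioo ht).ne']
  refine ((setLIntegral_pos_iff
    (contDiff_crossMode.continuous.measurable.enorm.pow_const 2)).mpr ?_).ne'
  rw [Set.inter_eq_right.mpr hsupp]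
  simp [Real.pi_pos]

lemma setLIntegral_crossMode_ne_top :
    ∫⁻ t in Set.Ioo 0 Real.pi, ‖crossMode t‖ₑ ^ 2 ≠ ⊤ :=
  lintegral_enorm_sq_ne_top contDiff_crossMode.continuous hasCompactSupport_crossMode

end TransverseMode

section QuasiMode

variable {θ : ℝ} {a : ℝ → ℂ}

lemma memH10_tensor_crossMode (hθ : θ ∈ Set.Ioo 0 (Real.pi / 2)) (ha : ContDiff ℝ ∞ a)
    (ha_compact : HasCompactSupport a) (ha_supp : tsupport a ⊆ Set.Ioi (Real.cos θ / Real.sin θ)) :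
    MemH10 (contL2 (brokenGuide θ)
      (contDiff_tensor (upperBasis θ) ha contDiff_crossMode).continuous
      (hasCompactSupport_tensor _ ha_compact hasCompactSupport_crossMode)) := by
  have hmul : tensor (upperBasis θ) a crossMode = fun x =>
      tensor (upperBasis θ) a (fun t => (crossBump t : ℂ)) x *
        (Real.sin ((upperBasis θ).repr x 1) : ℂ) :=
    funext fun x => (mul_assoc _ _ _).symm
  have hmem : ∀ x ∈ tsupport (tensor (upperBasis θ) a fun t => (crossBump t : ℂ)),
      x ∈ brokenGuide θ ↔ 0 < Real.sin ((upperBasis θ).repr x 1) := fun x hx => by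
    have hx := tsupport_tensor_subset _ hx
    have ht := tsupport_crossBump_subset hx.2
    rw [mem_brokenGuide_iff_of_mem_farArm hθ ⟨ha_supp hx.1, ht⟩]
    refine ⟨Real.sin_pos_of_mem_Ioo, fun hsin => ⟨?_, ?_⟩⟩
    · contrapose! hsin
      exact Real.sin_nonpos_of_nonpos_of_neg_pi_le hsin (by linarith [ht.1, Real.pi_gt_three])
    · contrapose! hsin
      rw [← neg_nonneg, ← Real.sin_sub_pi]
      exact Real.sin_nonneg_of_nonneg_of_le_pi (by linarith) (by linarith [ht.2, Real.pi_gt_three])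
  have h := memH10_contL2_mul (contDiff_tensor _ ha contDiff_crossBump)
    (hasCompactSupport_tensor _ ha_compact hasCompactSupport_crossBump)
    (Real.contDiff_sin.comp (contDiff_repr (upperBasis θ) 1)) hmem
    (hmul ▸ (contDiff_tensor (upperBasis θ) ha contDiff_crossMode).continuous)
  convert h using 2
  exact hmul

lemma contDiff_deriv_deriv_add_mul (ha : ContDiff ℝ ∞ a) (c : ℂ) :
    ContDiff ℝ ∞ fun s => deriv (deriv a) s + c * a s :=
  (contDiff_infty_iff_deriv.mp (contDiff_infty_iff_deriv.mp ha).2).2.add (contDiff_const.mul ha)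

lemma support_deriv_deriv_add_mul_subset (a : ℝ → ℂ) (c : ℂ) :
    Function.support (fun s => deriv (deriv a) s + c * a s) ⊆ tsupport a :=
  (Function.support_add _ _).trans <| Set.union_subset
    (support_deriv_subset.trans tsupport_deriv_subset)
    ((Function.support_mul_subset_right _ _).trans (subset_tsupport a))

lemma laplacian_tensor_crossMode_add (hθ : θ ∈ Set.Ioo 0 (Real.pi / 2)) (ha : ContDiff ℝ ∞ a)
    (ha_supp : tsupport a ⊆ Set.Ioi (Real.cos θ / Real.sin θ)) (c : ℂ) {x : Plane}
    (hx : x ∈ brokenGuide θ) :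
    Laplacian.laplacian (tensor (upperBasis θ) a crossMode) x +
        (1 + c) * tensor (upperBasis θ) a crossMode x =
      tensor (upperBasis θ) (fun s => deriv (deriv a) s + c * a s) crossMode x := by
  have hzero : tensor (upperBasis θ) a
      (fun t => deriv (deriv crossMode) t + 1 * crossMode t) x = 0 := by
    by_contra hne
    have ht := (mem_brokenGuide_iff_of_mem_farArm hθ (mem_farArm_of_tensor_ne_zero
      ((subset_tsupport a).trans ha_supp)
      ((support_deriv_deriv_add_mul_subset _ _).trans tsupport_crossMode_subset) hne)).mp hx
    exact right_ne_zero_of_mul hne (by simp only [deriv_deriv_crossMode ht, one_mul,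
      neg_add_cancel])
  rw [laplacian_tensor _ ha contDiff_crossMode]
  simp only [tensor] at hzero ⊢
  linear_combination hzero

theorem not_isFredholm_brokenGuide_of_disjoint_support (hθ : θ ∈ Set.Ioo 0 (Real.pi / 2))
    {a : ℕ → ℝ → ℂ} (ha : ∀ n, ContDiff ℝ ∞ (a n)) (ha_compact : ∀ n, HasCompactSupport (a n))
    (ha_supp : ∀ n, tsupport (a n) ⊆ Set.Ioi (Real.cos θ / Real.sin θ))
    (hdisj : Pairwise fun n m => Disjoint (Function.support (a n)) (Function.support (a m)))
    {m M : ℝ≥0∞} (hm : m ≠ 0) (hM : M ≠ ⊤) (hma : ∀ n, m ≤ ∫⁻ s, ‖a n s‖ₑ ^ 2)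
    (haM : ∀ n, ∫⁻ s, ‖a n s‖ₑ ^ 2 ≤ M) {c : ℂ}
    (hlim : Filter.Tendsto (fun n => ∫⁻ s, ‖deriv (deriv (a n)) s + c * a n s‖ₑ ^ 2)
      Filter.atTop (nhds 0)) :
    ¬ IsFredholm (subScalar (dirichletLaplacian (brokenGuide θ)) (1 + c)) := by
  let P : ℝ≥0∞ := ∫⁻ t in Set.Ioo 0 Real.pi, ‖crossMode t‖ₑ ^ 2
  have hmode_supp := (subset_tsupport crossMode).trans tsupport_crossMode_subset
  have hnorm : ∀ n, ∫⁻ x in (brokenGuide θ : Set Plane),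
      ‖tensor (upperBasis θ) (a n) crossMode x‖ₑ ^ 2 = (∫⁻ s, ‖a n s‖ₑ ^ 2) * P := fun n =>
    setLIntegral_brokenGuide_enorm_tensor_sq hθ (ha n).continuous
      ((subset_tsupport _).trans (ha_supp n)) contDiff_crossMode.continuous hmode_supp
  have hresidual : ∀ n, ∫⁻ x in (brokenGuide θ : Set Plane),
      ‖Laplacian.laplacian (tensor (upperBasis θ) (a n) crossMode) x +
        (1 + c) * tensor (upperBasis θ) (a n) crossMode x‖ₑ ^ 2 =
      (∫⁻ s, ‖deriv (deriv (a n)) s + c * a n s‖ₑ ^ 2) * P := fun n => by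
    rw [← setLIntegral_brokenGuide_enorm_tensor_sq hθ
      (contDiff_deriv_deriv_add_mul (ha n) c).continuous
      ((support_deriv_deriv_add_mul_subset _ _).trans (ha_supp n))
      contDiff_crossMode.continuous hmode_supp]
    exact setLIntegral_congr_fun (brokenGuide θ).isOpen.measurableSet fun x hx => by
      rw [laplacian_tensor_crossMode_add hθ (ha n) (ha_supp n) c hx]
  refine not_isFredholm_subScalar_of_disjoint_support
    (fun n => contDiff_tensor (upperBasis θ) (ha n) contDiff_crossMode)
    (fun n => hasCompactSupport_tensor _ (ha_compact n) hasCompactSupport_crossMode)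
    (fun n => memH10_tensor_crossMode hθ (ha n) (ha_compact n) (ha_supp n))
    (fun n k hnk => ?_) (mul_ne_zero hm setLIntegral_crossMode_ne_zero)
    (ENNReal.mul_ne_top hM setLIntegral_crossMode_ne_top) (fun n => ?_) (fun n => ?_) ?_
  · exact Set.disjoint_left.mpr fun x hxn hxk => Set.disjoint_left.mp (hdisj hnk)
      (left_ne_zero_of_mul hxn) (left_ne_zero_of_mul hxk)
  · exact hnorm n ▸ mul_le_mul_left (hma n) P
  · exact hnorm n ▸ mul_le_mul_left (haM n) P
  · simpa only [hresidual, zero_mul] using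
      ENNReal.Tendsto.mul_const hlim (Or.inr setLIntegral_crossMode_ne_top)

end QuasiMode

section Packet

variable {w : ℝ → ℂ} {R : ℝ}

/-- The wave packet of frequency `k` and envelope `w`, stretched to the length scale `R` and
normalised so that its `L²` norm does not depend on `R`. -/
def packet (w : ℝ → ℂ) (k R s : ℝ) : ℂ :=
  ((√R)⁻¹ : ℝ) * w (s / R) * Complex.exp (Complex.I * k * s)

lemma contDiff_packet (hw : ContDiff ℝ ∞ w) (k R : ℝ) : ContDiff ℝ ∞ (packet w k R) := by
  refine (contDiff_const.mul (hw.comp (contDiff_id.div_const R))).mul ?_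
  exact (contDiff_const.mul Complex.ofRealCLM.contDiff).cexp

lemma support_packet_subset (hw : Function.support w ⊆ Set.Ioo 1 2) (hR : 0 < R) (k : ℝ) :
    Function.support (packet w k R) ⊆ Set.Ioo R (2 * R) := fun s hs => by
  have hsR := hw (right_ne_zero_of_mul (left_ne_zero_of_mul hs))
  exact ⟨(one_lt_div hR).mp hsR.1, (div_lt_iff₀ hR).mp hsR.2⟩

lemma tsupport_packet_subset (hw : Function.support w ⊆ Set.Ioo 1 2) (hR : 0 < R) (k : ℝ) :
    tsupport (packet w k R) ⊆ Set.Icc R (2 * R) :=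
  closure_minimal ((support_packet_subset hw hR k).trans Set.Ioo_subset_Icc_self) isClosed_Icc

lemma deriv_packet (hw : Differentiable ℝ w) (k R : ℝ) :
    deriv (packet w k R) =
      packet (fun t => (R⁻¹ : ℝ) * deriv w t + Complex.I * k * w t) k R := by
  ext s
  have henvelope : HasDerivAt (fun s : ℝ => w (s / R)) ((R⁻¹ : ℝ) • deriv w (s / R)) s := by
    simpa [Function.comp_def] using
      (hw (s / R)).hasDerivAt.scomp s ((hasDerivAt_id s).div_const R)
  have hphase : HasDerivAt (fun s : ℝ => Complex.I * k * (s : ℂ)) (Complex.I * k) s := by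
    simpa using (hasDerivAt_id s).ofReal_comp.const_mul (Complex.I * (k : ℂ))
  refine ((henvelope.const_mul _).mul hphase.cexp).deriv.trans ?_
  simp only [packet, Complex.real_smul]
  ring

lemma deriv_deriv_packet_add (hw : ContDiff ℝ ∞ w) (k R s : ℝ) :
    deriv (deriv (packet w k R)) s + (k : ℂ) ^ 2 * packet w k R s =
      packet (fun t => (R⁻¹ : ℝ) *
        ((R⁻¹ : ℝ) * deriv (deriv w) t + 2 * Complex.I * k * deriv w t)) k R s := by
  have hw' : Differentiable ℝ w := hw.differentiable (by simp)
  have hw'' : Differentiable ℝ (deriv w) :=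
    (contDiff_infty_iff_deriv.mp hw).2.differentiable (by simp)
  have hsum : ∀ t, deriv (fun t => (R⁻¹ : ℝ) * deriv w t + Complex.I * k * w t) t =
      (R⁻¹ : ℝ) * deriv (deriv w) t + Complex.I * k * deriv w t := fun t =>
    (((hw'' t).hasDerivAt.const_mul _).add ((hw' t).hasDerivAt.const_mul _)).deriv
  rw [deriv_packet hw', deriv_packet ((hw''.const_mul _).fun_add (hw'.const_mul _))]
  simp only [packet, hsum]
  linear_combination ((√R)⁻¹ : ℝ) * w (s / R) * Complex.exp (Complex.I * k * s) * k ^ 2 *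
    Complex.I_sq

lemma enorm_packet_sq (hR : 0 < R) (w : ℝ → ℂ) (k s : ℝ) :
    ‖packet w k R s‖ₑ ^ 2 = ENNReal.ofReal R⁻¹ * ‖w (s / R)‖ₑ ^ 2 := by
  have hphase : ‖Complex.exp (Complex.I * k * s)‖ₑ = 1 := by
    rw [← ofReal_norm, Complex.norm_exp]
    simp
  have hscale : ‖(((√R)⁻¹ : ℝ) : ℂ)‖ₑ ^ 2 = ENNReal.ofReal R⁻¹ := by
    rw [← ofReal_norm, ← ENNReal.ofReal_pow (norm_nonneg _), Complex.norm_real,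
      Real.norm_eq_abs, sq_abs, inv_pow, Real.sq_sqrt hR.le]
  rw [packet, enorm_mul, enorm_mul, hphase, mul_one, mul_pow, hscale]

lemma lintegral_enorm_packet_sq (hw : Continuous w) (hR : 0 < R) (k : ℝ) :
    ∫⁻ s, ‖packet w k R s‖ₑ ^ 2 = ∫⁻ t, ‖w t‖ₑ ^ 2 := by
  have hmap := Real.smul_map_volume_mul_left (inv_ne_zero hR.ne')
  have hmeas : Measurable fun t => ‖w t‖ₑ ^ 2 := hw.measurable.enorm.pow_const 2
  simp_rw [enorm_packet_sq hR, div_eq_inv_mul]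
  conv_rhs => rw [← hmap, lintegral_smul_measure, lintegral_map hmeas (measurable_const_mul _)]
  rw [lintegral_const_mul' _ _ ENNReal.ofReal_ne_top, abs_of_pos (inv_pos.mpr hR),
    smul_eq_mul]

lemma tendsto_lintegral_deriv_deriv_packet_add (hw : ContDiff ℝ ∞ w)
    (hw_supp : HasCompactSupport w) (k : ℝ) {R : ℕ → ℝ} (hR_one : ∀ n, 1 ≤ R n)
    (hR : Filter.Tendsto R Filter.atTop Filter.atTop) :
    Filter.Tendsto (fun n => ∫⁻ s, ‖deriv (deriv (packet w k (R n))) s +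
      (k : ℂ) ^ 2 * packet w k (R n) s‖ₑ ^ 2) Filter.atTop (nhds 0) := by
  have hw' : ContDiff ℝ ∞ (deriv w) := (contDiff_infty_iff_deriv.mp hw).2
  have hw'' : ContDiff ℝ ∞ (deriv (deriv w)) := (contDiff_infty_iff_deriv.mp hw').2
  let J : ℝ≥0∞ := ∫⁻ t, ‖‖deriv (deriv w) t‖ + ‖2 * Complex.I * k * deriv w t‖‖ₑ ^ 2
  have hJ : J ≠ ⊤ := lintegral_enorm_sq_ne_top
    (hw''.continuous.norm.add (continuous_const.mul hw'.continuous).norm)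
    (hw_supp.deriv.deriv.norm.add hw_supp.deriv.mul_left.norm)
  have hbound : ∀ n, ∫⁻ s, ‖deriv (deriv (packet w k (R n))) s +
      (k : ℂ) ^ 2 * packet w k (R n) s‖ₑ ^ 2 ≤ ‖(R n)⁻¹‖ₑ ^ 2 * J := fun n => by
    have hR_pos : 0 < R n := one_pos.trans_le (hR_one n)
    simp_rw [deriv_deriv_packet_add hw]
    rw [lintegral_enorm_packet_sq (by fun_prop) hR_pos,
      ← lintegral_const_mul' _ _ (ENNReal.pow_ne_top enorm_ne_top)]
    refine lintegral_mono fun t => ?_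
    rw [← mul_pow, ← enorm_mul]
    gcongr
    rw [enorm_le_iff_norm_le, norm_mul, norm_mul, Complex.norm_real]
    gcongr
    refine (norm_add_le_of_le ?_ le_rfl).trans (Real.le_norm_self _)
    rw [norm_mul, Complex.norm_real, Real.norm_of_nonneg (inv_pos.mpr hR_pos).le]
    exact mul_le_of_le_one_left (norm_nonneg _) (inv_le_one_of_one_le₀ (hR_one n))
  refine tendsto_of_tendsto_of_tendsto_of_le_of_le tendsto_const_nhds ?_
    (fun _ => zero_le) hbound
  have hinv : Filter.Tendsto (fun n => ‖(R n)⁻¹‖ₑ ^ 2) Filter.atTop (nhds 0) := by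
    simpa using ENNReal.Tendsto.pow (n := 2) (tendsto_inv_atTop_zero.comp hR).enorm
  simpa only [zero_mul] using ENNReal.Tendsto.mul_const hinv (Or.inr hJ)

end Packet

section Main

/-- The envelope of the wave packets. Its support `[1, 2]` makes the packets stretched to distinct
powers of `2` disjoint. -/
def envelope : ContDiffBump (3 / 2 : ℝ) where
  rIn := 1 / 4
  rOut := 1 / 2
  rIn_pos := by norm_num
  rIn_lt_rOut := by norm_num

lemma support_envelope : Function.support (fun t => (envelope t : ℂ)) = Set.Ioo 1 2 := by
  have hball : Metric.ball (3 / 2 : ℝ) envelope.rOut = Set.Ioo 1 2 := by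
    rw [Real.ball_eq_Ioo]
    norm_num [envelope]
  rw [← hball, ← envelope.support_eq]
  exact Function.support_comp_eq _ Complex.ofReal_eq_zero envelope

lemma lintegral_envelope_ne_zero : ∫⁻ t, ‖(envelope t : ℂ)‖ₑ ^ 2 ≠ 0 := by
  have hmeas : Measurable fun t => ‖(envelope t : ℂ)‖ₑ ^ 2 :=
    (Complex.measurable_ofReal.comp envelope.continuous.measurable).enorm.pow_const 2
  have hsupp : (Function.support fun t => ‖(envelope t : ℂ)‖ₑ ^ 2) = Set.Ioo 1 2 := by
    rw [← support_envelope]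
    ext t
    simp
  refine ((lintegral_pos_iff_support hmeas).mpr ?_).ne'
  norm_num [hsupp]

theorem not_isFredholm_brokenGuide {θ : ℝ} (hθ : θ ∈ Set.Ioo 0 (Real.pi / 2)) (k : ℝ) :
    ¬ IsFredholm (subScalar (dirichletLaplacian (brokenGuide θ)) ((1 + k ^ 2 : ℝ) : ℂ)) := by
  obtain ⟨N, hN⟩ := pow_unbounded_of_one_lt (Real.cos θ / Real.sin θ) (one_lt_two (α := ℝ))
  let w : ℝ → ℂ := fun t => envelope t
  have hw : ContDiff ℝ ∞ w := Complex.ofRealCLM.contDiff.comp envelope.contDiff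
  have hw_compact : HasCompactSupport w :=
    envelope.hasCompactSupport.comp_left Complex.ofReal_zero
  let R : ℕ → ℝ := fun n => 2 ^ (n + N)
  have hR_one : ∀ n, 1 ≤ R n := fun n => one_le_pow₀ one_le_two
  have hR_pos : ∀ n, 0 < R n := fun n => one_pos.trans_le (hR_one n)
  have hR : Filter.Tendsto R Filter.atTop Filter.atTop :=
    (tendsto_pow_atTop_atTop_of_one_lt one_lt_two).comp (Filter.tendsto_add_atTop_nat N)
  have hR_arm : ∀ n, Real.cos θ / Real.sin θ < R n := fun n =>
    hN.trans_le (pow_le_pow_right₀ one_le_two (Nat.le_add_left N n))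
  have hR_double : ∀ n m, n < m → 2 * R n ≤ R m := fun n m hnm => by
    rw [← pow_succ']
    exact pow_le_pow_right₀ one_le_two (by lia)
  have htsupport : ∀ n, tsupport (packet w k (R n)) ⊆ Set.Icc (R n) (2 * R n) := fun n =>
    tsupport_packet_subset support_envelope.subset (hR_pos n) k
  have hdisj : Pairwise fun n m => Disjoint (Function.support (packet w k (R n)))
      (Function.support (packet w k (R m))) :=
    (pairwise_disjoint_on _).mpr fun n m hnm => (Set.Ioo_disjoint_Ioo.mpr
      ((min_le_left _ _).trans ((hR_double n m hnm).trans (le_max_right _ _)))).mono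
        (support_packet_subset support_envelope.subset (hR_pos n) k)
        (support_packet_subset support_envelope.subset (hR_pos m) k)
  push_cast
  exact not_isFredholm_brokenGuide_of_disjoint_support hθ
    (fun n => contDiff_packet hw k (R n))
    (fun n => isCompact_Icc.of_isClosed_subset (isClosed_tsupport _) (htsupport n))
    (fun n => (htsupport n).trans fun s hs => (hR_arm n).trans_le hs.1) hdisj
    lintegral_envelope_ne_zero (lintegral_enorm_sq_ne_top hw.continuous hw_compact)
    (fun n => (lintegral_enorm_packet_sq hw.continuous (hR_pos n) k).ge)
    (fun n => (lintegral_enorm_packet_sq hw.continuous (hR_pos n) k).le)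
    (tendsto_lintegral_deriv_deriv_packet_add hw hw_compact k hR_one hR)

end Main

end BrokenGuide

end

theorem proposition2p1 (θ : ℝ) (hθ : θ ∈ Set.Ioo 0 (Real.pi / 2)) :
    BrokenGuide.essentialSpectrum (BrokenGuide.dirichletLaplacian (BrokenGuide.brokenGuide θ)) =
      Complex.ofReal '' Set.Ici (1 : ℝ) := by
  ext z
  constructor
  · intro hz
    by_contra h
    exact hz (BrokenGuide.isFredholm_brokenGuide hθ h)
  · rintro ⟨r, hr, rfl⟩
    have h := BrokenGuide.not_isFredholm_brokenGuide hθ √(r - 1)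
    rwa [Real.sq_sqrt (sub_nonneg.mpr hr), add_sub_cancel] at h
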